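/- Let $g>0$, let $\pi_1$ be the fundamental group of the compact oriented surface $\Sigma_{g,1}$ of genus $g$ with one boundary component, based at a boundary point (free on $\mathbf u_1,\mathbf v_1,\dots,\mathbf u_g,\mathbf v_g$), $\partial=\prod_i[\mathbf u_i,\mathbf v_i]$ the class of the boundary, $H=H_1(\Sigma_{g,1};\mathbb Q)$, $\widehat T=\prod_{n\ge0}H^{\otimes n}$, $\widehat T_p=\prod_{n\ge p}H^{\otimes n}$. The mapping class group is $\mathcal M_{g,1}=\{\varphi\in\mathrm{Aut}(\pi_1):\varphi(\partial)=\partial\}$, and $\mathcal M_{g,1}[m]$ is the subgroup acting trivially on $\pi_1/\Gamma_m$, where $\Gamma_0=\pi_1$, $\Gamma_{m+1}=[\Gamma_m,\Gamma_0]$; in particular $\mathcal M_{g,1}[1]$ is the Torelli group and $\mathcal M_{g,1}[2]=\mathcal K_{g,1}$. For $\varphi\in\mathcal M_{g,1}[m]$, $m\ge1$, the Johnson homomorphism $\tau_m(\varphi)\in\mathrm{Hom}(H,H^{\otimes(m+1)})$ sends $[\mathbf x]$ to the image of $\varphi(\mathbf x)\mathbf x^{-1}$ under Magnus's embedding of $\Gamma_m/\Gamma_{m+1}$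 in $H^{\otimes (m+1)}$. A (generalized) Magnus expansion is a homomorphism $\theta:\pi_1\to1+\widehat T_1$ with $\theta(\mathbf x)\equiv1+[\mathbf x]$ modulo $\widehat T_2$. Let $IA(\widehat T)$ be the group of filtration-preserving algebra automorphisms of $\widehat T$ acting trivially on $\widehat T_1/\widehat T_2$; for $U\in IA(\widehat T)$ let $U_m\in\mathrm{Hom}(H,H^{\otimes(m+1)})$ be the degree $m+1$ component of $U|_H$. For a Magnus expansion $\theta$ let $\tau^\theta(\varphi)\in IA(\widehat T)$ be the total Johnson map, the unique element of $IA(\widehat T)$ with $\tau^\theta(\varphi)\circ|\varphi|\circ\theta=\theta\circ\varphi$, where $|\varphi|$ is the action on $\widehat T$ induced from homology (so $\tau^\theta(\varphi)=\theta\circ\varphi\circ\theta^{-1}$ on the Torelli group). A marked trivalent fatgraph $G$ consists of a genus $g$ fatgraph with one boundary cycle and one univalent vertex, all other vertices being trivalent, and a map (written $\mathbf x\mapsto\mathbf x$) from its oriented edges to $\pi_1$ such that $\bar{\mathbf x}=\mathbf x^{-1}$ for the reversed edge; $\mathbf{a}\mathbf{b}\mathbf{e}=1$ for the cyclically ordered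 incoming edges at each trivalent vertex; the image generates $\pi_1$; and $\bar{\mathbf t}=\partial$ for the edge $\mathbf t$ (the tail) pointing away from the univalent vertex. Mapping classes act by composition with the marking. The boundary cycle follows an incoming edge by the outgoing edge which is next in the cyclic order. For an oriented edge $\mathbf x$ put $\ell^G_1(\mathbf x)=[\mathbf x]$ and recursively, for $n\ge2$, $$\ell^G_n(\mathbf x)=-\tfrac13\sum_{i=1}^r h\big(\ell^G(\mathbf f_{i-1}),-\ell^G(\mathbf f_i)\big)_{(n)},\qquad h(X,Y)=\log(\exp X\exp Y)-X-Y,$$ if the path $\mathbf x=\mathbf f_0,\dots,\mathbf f_r=\bar{\mathbf x}$ along the boundary cycle does not pass through the univalent vertex, and $\ell^G_n(\mathbf x)=-\ell^G_n(\bar{\mathbf x})$ otherwise. The fatgraph Magnus expansion $\theta^G$ is the unique Magnus expansion with $\theta^G(\mathbf x)=\exp\ell^G(\mathbf x)$ for all oriented edges $\mathbf x$. A Whitehead move $W:G\to G'$ of marked trivalent fatgraphs collapses a non-tail edge with distinct endpoints and expands the resulting $4$-valent vertex in the other way, keeping the marks of all other edges. Its fatgraph Johnson map $\tau(W)=\tau^{GG'}=\theta^G\circ(\theta^{G'})^{-1}$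 is the unique element of $IA(\widehat T)$ taking $\theta^{G'}$ to $\theta^G$, and $\tau_m(W)=\tau(W)_m$. **Theorem.** Let $G=G_0\xrightarrow{W_1}G_1\xrightarrow{W_2}\cdots\xrightarrow{W_k}G_k=\varphi(G)$ be a sequence of Whitehead moves of marked trivalent fatgraphs, where $\varphi\in\mathcal M_{g,1}$. Then all the expansions $\theta^{G_i}$ and the maps $\tau(W_i)$ and $\tau^{\theta^G}(\varphi)$ are well defined (they exist and are unique), and: 1. $\tau^{\theta^{G}}_1(\varphi)=\sum_{i=1}^k\tau_1(W_i)$. If $\varphi\in\mathcal M_{g,1}[1]$, then for every Magnus expansion $\theta$ the map $\tau^\theta(\varphi)$ is well defined, and $$\tau_1(\varphi)=\tau_1^\theta(\varphi)=\sum_{i=1}^k\tau_1(W_i).$$ 2. If $\varphi\in\mathcal M_{g,1}[2]=\mathcal K_{g,1}$, then for every Magnus expansion $\theta$ $$\tau_2(\varphi)=\tau_2^\theta(\varphi)=\sum_{i=1}^k\Big[\tau_2(W_i)-\big(\tau_1(W_i)\otimes1+1\otimes\tau_1(W_i)\big)\circ\sum_{j=1}^i\tau_1(W_j)\Big].$$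 -/

import Mathlib

/-! # Noncommutative formal power series -/

/-- Formal power series over `ℚ` in noncommuting variables indexed by `ι`: a series is given by its
coefficients, indexed by the words in `ι`.  For finite `ι` and `H = ι → ℚ` this is the completed
tensor algebra `∏ₙ H^{⊗ n}`; words of length `n` index the standard basis of `H^{⊗ n}`. -/
@[ext] structure NCSeries (ι : Type) where
  /-- the coefficient of a word -/
  coeff : List ι → ℚ

namespace NCSeries

variable {ι : Type}

instance : Zero (NCSeries ι) := ⟨⟨fun _ => 0⟩⟩
instance : Add (NCSeries ι) := ⟨fun f h => ⟨fun w => f.coeff w + h.coeff w⟩⟩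
instance : Neg (NCSeries ι) := ⟨fun f => ⟨fun w => -f.coeff w⟩⟩
instance : SMul ℚ (NCSeries ι) := ⟨fun c f => ⟨fun w => c * f.coeff w⟩⟩

/-- The Cauchy product: sum over all ways to cut the word `w` into two pieces. -/
instance : Mul (NCSeries ι) :=
  ⟨fun f h =>
    ⟨fun w => ∑ i ∈ Finset.range (w.length + 1), f.coeff (w.take i) * h.coeff (w.drop i)⟩⟩

instance : One (NCSeries ι) :=
  ⟨⟨fun w => match w with
    | [] => 1
    | _ :: _ => 0⟩⟩

@[simp] theorem coeff_zero (w : List ι) : (0 : NCSeries ι).coeff w = 0 := rfl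

@[simp] theorem coeff_add (f h : NCSeries ι) (w : List ι) :
    (f + h).coeff w = f.coeff w + h.coeff w := rfl

@[simp] theorem coeff_neg (f : NCSeries ι) (w : List ι) : (-f).coeff w = -f.coeff w := rfl

@[simp] theorem coeff_smul (c : ℚ) (f : NCSeries ι) (w : List ι) :
    (c • f).coeff w = c * f.coeff w := rfl

theorem coeff_mul (f h : NCSeries ι) (w : List ι) : (f * h).coeff w =
    ∑ i ∈ Finset.range (w.length + 1), f.coeff (w.take i) * h.coeff (w.drop i) := rfl

@[simp] theorem coeff_one_nil : (1 : NCSeries ι).coeff [] = 1 := rfl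

@[simp] theorem coeff_one_cons (a : ι) (w : List ι) : (1 : NCSeries ι).coeff (a :: w) = 0 := rfl

instance : AddCommGroup (NCSeries ι) where
  add_assoc f h k := by ext w; simp [add_assoc]
  zero_add f := by ext w; simp
  add_zero f := by ext w; simp
  add_comm f h := by ext w; simp [add_comm]
  neg_add_cancel f := by ext w; simp
  nsmul := nsmulRec
  zsmul := zsmulRec

@[simp] theorem coeff_sub (f h : NCSeries ι) (w : List ι) :
    (f - h).coeff w = f.coeff w - h.coeff w := by
  rw [sub_eq_add_neg, coeff_add, coeff_neg, sub_eq_add_neg]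

instance : Module ℚ (NCSeries ι) where
  one_smul f := by ext w; simp
  mul_smul c d f := by ext w; simp [mul_assoc]
  smul_zero c := by ext w; simp
  smul_add c f h := by ext w; simp [mul_add]
  add_smul c d f := by ext w; simp [add_mul]
  zero_smul f := by ext w; simp

@[simp] theorem coeff_mul_nil (f h : NCSeries ι) :
    (f * h).coeff [] = f.coeff [] * h.coeff [] := by
  simp [coeff_mul]

/-- The series of the coefficients of words that begin with `a`, with this letter removed. -/
def tail (a : ι) (f : NCSeries ι) : NCSeries ι := ⟨fun v => f.coeff (a :: v)⟩

theorem coeff_mul_cons (f h : NCSeries ι) (a : ι) (w : List ι) : (f * h).coeff (a :: w) =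
    f.coeff [] * h.coeff (a :: w) + (tail a f * h).coeff w := by
  rw [coeff_mul, List.length_cons, Finset.sum_range_succ', add_comm]
  simp [coeff_mul, tail]

protected theorem add_mul' (f f' h : NCSeries ι) : (f + f') * h = f * h + f' * h := by
  ext w
  simp [coeff_mul, add_mul, Finset.sum_add_distrib]

protected theorem mul_add' (f h h' : NCSeries ι) : f * (h + h') = f * h + f * h' := by
  ext w
  simp [coeff_mul, mul_add, Finset.sum_add_distrib]

protected theorem smul_mul' (c : ℚ) (f h : NCSeries ι) : (c • f) * h = c • (f * h) := by
  ext w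
  simp [coeff_mul, Finset.mul_sum, mul_assoc]

protected theorem mul_smul' (c : ℚ) (f h : NCSeries ι) : f * (c • h) = c • (f * h) := by
  ext w
  simp [coeff_mul, Finset.mul_sum, mul_left_comm]

protected theorem zero_mul' (f : NCSeries ι) : 0 * f = 0 := by
  ext w
  simp [coeff_mul]

protected theorem mul_zero' (f : NCSeries ι) : f * 0 = 0 := by
  ext w
  simp [coeff_mul]

protected theorem one_mul' (f : NCSeries ι) : 1 * f = f := by
  ext w
  cases w with
  | nil => simp
  | cons a w =>
    have e : tail a (1 : NCSeries ι) = 0 := rfl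
    rw [coeff_mul_cons, e, NCSeries.zero_mul']
    simp

protected theorem mul_one' (f : NCSeries ι) : f * 1 = f := by
  ext w
  induction w generalizing f with
  | nil => simp
  | cons a w ih =>
    rw [coeff_mul_cons, ih]
    simp [tail]

protected theorem mul_assoc' (f h k : NCSeries ι) : f * h * k = f * (h * k) := by
  ext w
  induction w generalizing f h with
  | nil => simp [mul_assoc]
  | cons a w ih =>
    have e : tail a (f * h) = f.coeff [] • tail a h + tail a f * h := by
      ext v
      exact coeff_mul_cons f h a v
    rw [coeff_mul_cons, coeff_mul_cons, e, NCSeries.add_mul', NCSeries.smul_mul',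
      coeff_mul_cons h k, coeff_add, coeff_smul, ih, coeff_mul_nil]
    ring

instance : Ring (NCSeries ι) :=
  { (inferInstance : AddCommGroup (NCSeries ι)),
    (inferInstance : Mul (NCSeries ι)),
    (inferInstance : One (NCSeries ι)) with
    left_distrib := NCSeries.mul_add'
    right_distrib := NCSeries.add_mul'
    zero_mul := NCSeries.zero_mul'
    mul_zero := NCSeries.mul_zero'
    mul_assoc := NCSeries.mul_assoc'
    one_mul := NCSeries.one_mul'
    mul_one := NCSeries.mul_one' }

instance : Algebra ℚ (NCSeries ι) :=
  Algebra.ofModule NCSeries.smul_mul' NCSeries.mul_smul'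

/-- The inclusion of `H = ι → ℚ` in the algebra, as the part of degree one. -/
def ofH : (ι → ℚ) →ₗ[ℚ] NCSeries ι where
  toFun v := ⟨fun w => match w with
    | [i] => v i
    | _ => 0⟩
  map_add' v v' := by
    ext w
    rcases w with _ | ⟨a, _ | ⟨b, w⟩⟩ <;> simp
  map_smul' c v := by
    ext w
    rcases w with _ | ⟨a, _ | ⟨b, w⟩⟩ <;> simp

/-- The homogeneous component of degree `n`. -/
def homog (n : ℕ) : NCSeries ι →ₗ[ℚ] NCSeries ι where
  toFun f := ⟨fun w => if w.length = n then f.coeff w else 0⟩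
  map_add' f h := by
    ext w
    by_cases H : w.length = n <;> simp [H]
  map_smul' c f := by
    ext w
    by_cases H : w.length = n <;> simp [H]

/-- Membership in the `p`-th ideal `∏_{i ≥ p} H^{⊗ i}` of the filtration. -/
def InFil (p : ℕ) (f : NCSeries ι) : Prop := ∀ w : List ι, w.length < p → f.coeff w = 0

/-- `exp X` for a series `X` without constant term: only the powers `X ^ n` with `n ≤ |w|`
contribute to the coefficient of `w`. -/
noncomputable def exp (X : NCSeries ι) : NCSeries ι :=
  ⟨fun w => ∑ n ∈ Finset.range (w.length + 1), (n.factorial : ℚ)⁻¹ * (X ^ n).coeff w⟩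

/-- `log Z` for a series `Z` with constant term `1`. -/
noncomputable def log (Z : NCSeries ι) : NCSeries ι :=
  ⟨fun w => ∑ n ∈ Finset.Icc 1 w.length, ((-1 : ℚ) ^ (n + 1) / (n : ℚ)) * ((Z - 1) ^ n).coeff w⟩

/-- The Hausdorff series without its linear part: `log (exp X exp Y) = X + Y + h(X, Y)`. -/
noncomputable def hausdorff (X Y : NCSeries ι) : NCSeries ι := log (exp X * exp Y) - X - Y

variable [Fintype ι] [DecidableEq ι]

/-- For a linear map `f` on `H`, the linear map `f ⊗ 1 + 1 ⊗ f` on `H ⊗ H` (components of a series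
in degrees other than two are ignored). -/
noncomputable def deriv2 (f : (ι → ℚ) →ₗ[ℚ] NCSeries ι) : NCSeries ι →ₗ[ℚ] NCSeries ι where
  toFun s := ∑ i, ∑ j, s.coeff [i, j] •
    (f (Pi.single i 1) * ofH (Pi.single j 1) + ofH (Pi.single i 1) * f (Pi.single j 1))
  map_add' s s' := by
    simp only [coeff_add, add_smul, Finset.sum_add_distrib]
  map_smul' c s := by
    simp only [coeff_smul, mul_smul, Finset.smul_sum, RingHom.id_apply]

/-- A filtration-preserving algebra automorphism that acts trivially on the quotient of the first
by the second ideal of the filtration, i.e. an element of the group `IA`. -/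
def IsIA (U : NCSeries ι ≃ₐ[ℚ] NCSeries ι) : Prop :=
  (∀ p f, InFil p (U f) ↔ InFil p f) ∧ ∀ f, InFil 1 f → InFil 2 (U f - f)

/-- The `m`-th component in `Hom(H, H^{⊗ (m + 1)})` of an element `U` of `IA`, under the
identification of `U` with `U|_H - id`, for `m ≥ 1`. -/
noncomputable def component (m : ℕ) (U : NCSeries ι ≃ₐ[ℚ] NCSeries ι) :
    (ι → ℚ) →ₗ[ℚ] NCSeries ι :=
  homog (m + 1) ∘ₗ U.toLinearMap ∘ₗ ofH

end NCSeries

/-! # The surface group, its mapping class group and Johnson maps -/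

namespace FatgraphJohnson

open NCSeries

/-- Indices of a symplectic generating set: `inl i` for `uᵢ` and `inr i` for `vᵢ`. -/
abbrev Idx (g : ℕ) : Type := Fin g ⊕ Fin g

/-- The fundamental group of the genus `g` surface with one boundary component, with base point
on the boundary: it is free on `u₁, v₁, …, u_g, v_g`. -/
abbrev Pi1 (g : ℕ) : Type := FreeGroup (Idx g)

/-- Rational first homology, with the classes of the `uᵢ`, `vᵢ` as standard basis. -/
abbrev H (g : ℕ) : Type := Idx g → ℚ

/-- The completed tensor algebra of `H`. -/
abbrev That (g : ℕ) : Type := NCSeries (Idx g)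

variable {g : ℕ}

/-- The class of the boundary path, `∏ᵢ [uᵢ, vᵢ]`. -/
def boundary (g : ℕ) : Pi1 g :=
  (List.ofFn fun i : Fin g =>
    (FreeGroup.of (Sum.inl i) * FreeGroup.of (Sum.inr i) * (FreeGroup.of (Sum.inl i))⁻¹ *
      (FreeGroup.of (Sum.inr i))⁻¹ : Pi1 g)).prod

/-- The homology class, as a homomorphism to the multiplicative version of `H`. -/
def clsHom (g : ℕ) : Pi1 g →* Multiplicative (H g) :=
  FreeGroup.lift fun i => Multiplicative.ofAdd (Pi.single i 1)

/-- The homology class of an element of the fundamental group. -/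
def cls (x : Pi1 g) : H g := (clsHom g x).toAdd

/-- The mapping class group, through its faithful action on the fundamental group (Dehn, Nielsen):
the automorphisms that fix the class of the boundary. -/
def MCG (g : ℕ) : Subgroup (MulAut (Pi1 g)) := MulAction.stabilizer (MulAut (Pi1 g)) (boundary g)

/-- The `k`-th Torelli group: the mapping classes that act trivially on the quotient of the
fundamental group by `Γ_k`, where `Γ_0` is the whole group and `Γ_{k+1} = [Γ_k, Γ_0]`. -/
def torelli (g k : ℕ) : Set (MCG g) :=
  {φ | ∀ x : Pi1 g, φ.1 x * x⁻¹ ∈ (⊤ : Subgroup (Pi1 g)).lowerCentralSeries k}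

/-- Generalized Magnus expansions: homomorphisms `θ` to the multiplicative group `1 + T̂₁` with
`θ(a) = 1 + [a] + (terms of degree at least two)`. -/
def IsMagnus (θ : Pi1 g →* That g) : Prop :=
  ∀ a : Pi1 g, (θ a).coeff [] = 1 ∧ ∀ i, (θ a).coeff [i] = cls a i

/-- `U` is an element of `IA` that takes `θ₂` to `θ₁`. -/
def Takes (θ₂ θ₁ : Pi1 g → That g) (U : That g ≃ₐ[ℚ] That g) : Prop :=
  IsIA U ∧ ∀ x, U (θ₂ x) = θ₁ x

/-- The element `θ₁ ∘ θ₂⁻¹` of `IA` that takes `θ₂` to `θ₁` (meaningful if there is exactly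
one). -/
noncomputable def transition (θ₁ θ₂ : Pi1 g → That g) : That g ≃ₐ[ℚ] That g :=
  Classical.epsilon (Takes θ₂ θ₁)

/-- The action `|φ|` of an automorphism `φ` of the fundamental group on the completed tensor algebra
that is induced by its action on homology. -/
noncomputable def homAct (φ : MulAut (Pi1 g)) (s : That g) : That g :=
  ⟨fun w => ∑ v : Fin w.length → Idx g,
    s.coeff (List.ofFn v) * ∏ j, cls (φ (FreeGroup.of (v j))) (w.get j)⟩

/-- The total Johnson map `τ^θ(φ) = θ ∘ φ ∘ θ⁻¹ ∘ |φ|⁻¹` of an expansion `θ`, i.e. the element of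
`IA` that takes `|φ| ∘ θ` to `θ ∘ φ`.  On the Torelli group, `|φ|` is the identity, and this is
`θ ∘ φ ∘ θ⁻¹`. -/
noncomputable def totalJohnson (θ : Pi1 g →* That g) (φ : MCG g) : That g ≃ₐ[ℚ] That g :=
  transition (fun x => θ (φ.1 x)) (fun x => homAct φ.1 (θ x))

theorem cls_of (i : Idx g) : cls (FreeGroup.of i : Pi1 g) = Pi.single i 1 := by
  simp [cls, clsHom]

theorem cls_of_torelli {φ : MCG g} (hφ : φ ∈ torelli g 1) (x : Pi1 g) :
    cls (φ.1 x) = cls x := by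
  have h : φ.1 x * x⁻¹ ∈ commutator (Pi1 g) := by
    rw [← Subgroup.top_lowerCentralSeries_one]
    exact hφ x
  have h2 := Abelianization.commutator_subset_ker (clsHom g) h
  rw [MonoidHom.mem_ker, map_mul, map_inv, mul_inv_eq_one] at h2
  simp [cls, h2]

/-- On the Torelli group, `|φ|` is the identity. -/
theorem homAct_of_torelli {φ : MCG g} (hφ : φ ∈ torelli g 1) (s : That g) :
    homAct φ.1 s = s := by
  ext w
  simp only [homAct]
  rw [Finset.sum_eq_single w.get]
  · simp [cls_of_torelli hφ, cls_of]
  · intro v _ hv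
    obtain ⟨j, hj⟩ := Function.ne_iff.1 hv
    rw [Finset.prod_eq_zero (Finset.mem_univ j), mul_zero]
    rw [cls_of_torelli hφ, cls_of]
    exact Pi.single_eq_of_ne (Ne.symm hj) _
  · simp

/-- The geometric series `∑ₙ (-xᵢ)ⁿ`. -/
def geom (i : Idx g) : That g :=
  ⟨fun w => if w = List.replicate w.length i then (-1) ^ w.length else 0⟩

theorem tail_geom (i a : Idx g) :
    (geom i).tail a = (if a = i then (-1 : ℚ) else 0) • geom i := by
  ext v
  by_cases h : a = i
  · simp only [geom, NCSeries.tail, h, List.length_cons, List.replicate_succ, pow_succ,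
      List.cons.injEq, true_and, coeff_smul, if_true]
    split_ifs <;> simp
  · simp [geom, NCSeries.tail, h, List.replicate_succ]

theorem tail_ofH (i a : Idx g) :
    (ofH (Pi.single i 1)).tail a = (if a = i then (1 : ℚ) else 0) • (1 : That g) := by
  ext v
  by_cases h : a = i <;> cases v <;> simp [ofH, NCSeries.tail, h]

theorem geom_cons (i a : Idx g) (w : List (Idx g)) :
    (geom i).coeff (a :: w) = (if a = i then (-1 : ℚ) else 0) * (geom i).coeff w :=
  congrArg (fun f : That g => f.coeff w) (tail_geom i a)

theorem ofH_cons (i a : Idx g) (w : List (Idx g)) : (ofH (Pi.single i 1)).coeff (a :: w) =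
    (if a = i then (1 : ℚ) else 0) * (1 : That g).coeff w :=
  congrArg (fun f : That g => f.coeff w) (tail_ofH i a)

/-- The unit `1 + xᵢ`. -/
def stdUnit (i : Idx g) : (That g)ˣ where
  val := 1 + ofH (Pi.single i 1)
  inv := geom i
  val_inv := by
    ext w
    rw [add_mul, one_mul, coeff_add]
    rcases w with _ | ⟨a, w⟩
    · simp [ofH, geom]
    · rw [coeff_mul_cons, tail_ofH, smul_mul_assoc, one_mul, geom_cons, coeff_smul]
      by_cases h : a = i <;> simp [h, ofH]
  inv_val := by
    ext w
    rw [mul_add, mul_one, coeff_add]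
    induction w with
    | nil => simp [ofH, geom]
    | cons a w ih =>
      rw [coeff_mul_cons, tail_geom, smul_mul_assoc, coeff_smul, geom_cons, ofH_cons, ← ih]
      have h0 : (geom i : That g).coeff [] = 1 := by simp [geom]
      by_cases h : a = i <;> simp [h, h0]

/-- The standard Magnus expansion, `xᵢ ↦ 1 + xᵢ` on the generators. -/
noncomputable def stdMagnus (g : ℕ) : Pi1 g →* That g :=
  (Units.coeHom (That g)).comp (FreeGroup.lift stdUnit)

/-- The `m`-th Johnson homomorphism on the `m`-th Torelli group: for `φ` in that group,
`φ(x) x⁻¹` lies in `Γ_m`, and `τ_m(φ)` sends `[x]` to its class in `Γ_m / Γ_{m+1}`, which Magnus's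
isomorphism (the leading term, of degree `m + 1`, of the standard Magnus expansion) identifies with
the degree `m + 1` part of the free Lie algebra on `H`, a subspace of `H^{⊗ (m + 1)}`.
The linear map is given by its values on the basis `[xᵢ]`. -/
noncomputable def johnsonHom (m : ℕ) (φ : MCG g) : H g →ₗ[ℚ] That g :=
  Fintype.linearCombination ℚ fun i : Idx g =>
    homog (m + 1) (stdMagnus g (φ.1 (FreeGroup.of i) * (FreeGroup.of i)⁻¹))

/-! # Marked trivalent fatgraphs -/

/-- A trivalent once-bordered fatgraph of genus `g`.  Its oriented edges are the elements of `Dart`;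
`bar` reverses orientation, and `next` is the cyclic order on the oriented edges that point to
the same vertex.  The tail points away from the only univalent vertex; all other
vertices have valence three.  After an incoming edge `x`, a boundary cycle continues with the outgoing
edge `bar (next x)`, and there is just one boundary cycle (so the graph is connected).
If there are `E` edges and `V` vertices, then `2 E = 3 (V - 1) + 1`, and genus `g` means
`V - E + 1 = 2 - 2 g`; together this says that there are `2 E = 12 g - 2` oriented edges. -/
structure TrivalentFatgraph (g : ℕ) where
  /-- oriented edges -/
  Dart : Type
  [fintypeDart : Fintype Dart]
  /-- reversal of orientation -/
  bar : Equiv.Perm Dart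
  /-- cyclic order at the vertex to which an oriented edge points -/
  next : Equiv.Perm Dart
  /-- the tail, oriented away from the univalent vertex -/
  tail : Dart
  bar_bar : ∀ x, bar (bar x) = x
  bar_ne : ∀ x, bar x ≠ x
  next_next_next : ∀ x, next (next (next x)) = x
  next_eq_self_iff : ∀ x, next x = x ↔ x = bar tail
  one_boundary : ∀ x y, (bar * next).SameCycle x y
  genus : Fintype.card Dart + 2 = 12 * g

/-- A marked trivalent fatgraph: a trivalent fatgraph with a `π`-marking.  Vertex
compatibility concerns the vertices other than the univalent one. -/
structure MarkedFatgraph (g : ℕ) extends TrivalentFatgraph g where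
  /-- the element of the fundamental group that marks an oriented edge -/
  mark : Dart → Pi1 g
  mark_bar : ∀ x, mark (bar x) * mark x = 1
  mark_vertex : ∀ x, x ≠ bar tail → mark x * mark (next x) * mark (next (next x)) = 1
  mark_full : Subgroup.closure (Set.range mark) = ⊤
  mark_tail : mark (bar tail) = boundary g

namespace MarkedFatgraph

/-- The fatgraph `φ(G)`: the marking is composed with the mapping class `φ`. -/
def act (φ : MCG g) (G : MarkedFatgraph g) : MarkedFatgraph g where
  toTrivalentFatgraph := G.toTrivalentFatgraph
  mark x := φ.1 (G.mark x)
  mark_bar x := by rw [← map_mul, G.mark_bar, map_one]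
  mark_vertex x hx := by rw [← map_mul, ← map_mul, G.mark_vertex x hx, map_one]
  mark_full := by
    have h : Set.range (fun x => φ.1 (G.mark x)) =
        (φ.1.toMonoidHom : Pi1 g →* Pi1 g) '' Set.range G.mark := by
      rw [← Set.range_comp]
      rfl
    rw [h, ← MonoidHom.map_closure, G.mark_full]
    exact Subgroup.map_top_of_surjective _ φ.1.surjective
  mark_tail := by
    rw [G.mark_tail]
    exact φ.2

/-- Isomorphism of marked fatgraphs. -/
def Iso (G G' : MarkedFatgraph g) : Prop :=
  ∃ f : G.Dart ≃ G'.Dart, (∀ x, f (G.bar x) = G'.bar (f x)) ∧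
    (∀ x, f (G.next x) = G'.next (f x)) ∧ f G.tail = G'.tail ∧ ∀ x, G'.mark (f x) = G.mark x

/-- `G'` results from `G` by a Whitehead move.  A non-tail edge `e` with distinct endpoints is
collapsed; if the incoming edges at its endpoints are cyclically ordered as `(e, a, b)` and
`(bar e, c, d)`, then the four-valent vertex `(a, b, c, d)` so obtained is expanded the other way,
into vertices `(e', b, c)` and `(bar e', d, a)` with a new edge `e'`.  Everything else,
including the marks of the other edges, is kept.  The bijection `f` identifies the oriented edges of
`G` and `G'`, and `e` with `e'`. -/
def WhiteheadMove (G G' : MarkedFatgraph g) : Prop :=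
  ∃ (f : G.Dart ≃ G'.Dart) (e a b c d : G.Dart),
    e ≠ G.tail ∧ e ≠ G.bar G.tail ∧ ¬ G.next.SameCycle e (G.bar e) ∧
    (G.next e = a ∧ G.next a = b ∧ G.next b = e) ∧
    (G.next (G.bar e) = c ∧ G.next c = d ∧ G.next d = G.bar e) ∧
    (∀ x, f (G.bar x) = G'.bar (f x)) ∧ f G.tail = G'.tail ∧
    (∀ x, x ≠ e → x ≠ G.bar e → G'.mark (f x) = G.mark x) ∧
    (G'.next (f e) = f b ∧ G'.next (f b) = f c ∧ G'.next (f c) = f e) ∧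
    (G'.next (f (G.bar e)) = f d ∧ G'.next (f d) = f a ∧ G'.next (f a) = f (G.bar e)) ∧
    ∀ x, ¬ G.next.SameCycle e x → ¬ G.next.SameCycle (G.bar e) x →
      G'.next (f x) = f (G.next x)

/-! # The fatgraph Magnus expansion -/

/-- The successor of an oriented edge on the boundary cycle. -/
def succ (G : MarkedFatgraph g) : Equiv.Perm G.Dart := G.bar * G.next

/-- The number of steps on the boundary cycle from `x` to the reverse of `x`. -/
noncomputable def steps (G : MarkedFatgraph g) (x : G.Dart) : ℕ :=
  sInf {k | (G.succ ^ k) x = G.bar x}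

/-- The edge-path from `x` to the reverse of `x` along the boundary cycle avoids the tail, i.e. it does
not pass through the univalent vertex, where the boundary cycle goes from the reverse of the tail to
the tail.  Thus the boundary cycle is cut open at the univalent vertex, and the
path of the tail itself is the whole cycle, from the tail to its reverse. -/
def AvoidsTail (G : MarkedFatgraph g) (x : G.Dart) : Prop :=
  ∀ i < G.steps x, (G.succ ^ i) x ≠ G.bar G.tail

/-- `-(1/3) ∑ᵢ h(L(f_{i-1}), -L(f_i))`, the sum being over the edge-path `f_0, …, f_k` from `x` to
its reverse along the boundary cycle. -/
noncomputable def pathSum (G : MarkedFatgraph g) (L : G.Dart → That g) (x : G.Dart) : That g :=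
  (-(1 / 3) : ℚ) • ∑ i ∈ Finset.range (G.steps x),
    hausdorff (L ((G.succ ^ i) x)) (-L ((G.succ ^ (i + 1)) x))

open Classical in
/-- The partial sum `ℓ_1 + ⋯ + ℓ_n` of the components of `ℓ`: `ℓ_1(x)` is the homology class of `x`,
and, for `n ≥ 2`, `ℓ_n(x)` is the degree `n` component of the path sum, which involves only the
components of `ℓ` of degrees less than `n`. -/
noncomputable def ellPartial (G : MarkedFatgraph g) : ℕ → G.Dart → That g
  | 0, _ => 0
  | 1, x => ofH (cls (G.mark x))
  | n + 2, x => ellPartial G (n + 1) x +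
      if G.AvoidsTail x then homog (n + 2) (pathSum G (ellPartial G (n + 1)) x)
      else -homog (n + 2) (pathSum G (ellPartial G (n + 1)) (G.bar x))

/-- The series `ℓ(x) = ∑ₙ ℓ_n(x)`. -/
noncomputable def ell (G : MarkedFatgraph g) (x : G.Dart) : That g :=
  ⟨fun w => (G.ellPartial w.length x).coeff w⟩

/-- `θ` is a generalized Magnus expansion that extends `x ↦ exp (ℓ(x))` on the oriented edges. -/
def IsFatgraphMagnus (G : MarkedFatgraph g) (θ : Pi1 g →* That g) : Prop :=
  IsMagnus θ ∧ ∀ x : G.Dart, θ (G.mark x) = NCSeries.exp (G.ell x)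

/-- The fatgraph Magnus expansion `θ^G` (meaningful if there is exactly one). -/
noncomputable def magnus (G : MarkedFatgraph g) : Pi1 g →* That g :=
  Classical.epsilon G.IsFatgraphMagnus

/-- The fatgraph Johnson map `τ^{G G'} = θ^G ∘ (θ^{G'})⁻¹`, the element of `IA` that takes `θ^{G'}` to
`θ^G`. -/
noncomputable def fatgraphJohnson (G G' : MarkedFatgraph g) : That g ≃ₐ[ℚ] That g :=
  transition G.magnus G'.magnus

end MarkedFatgraph

/-- For a sequence `G_0 → G_1 → ⋯ → G_k` of Whitehead moves, the component `τ_m(W)` of the fatgraph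
Johnson map of the move `W` from the `i`-th to the next fatgraph (counting from zero). -/
noncomputable def moveJohnson {k : ℕ} (G : Fin (k + 1) → MarkedFatgraph g) (m : ℕ) (i : Fin k) :
    H g →ₗ[ℚ] That g :=
  component m ((G i.castSucc).fatgraphJohnson (G i.succ))

end FatgraphJohnson

open NCSeries FatgraphJohnson

/-! The group `IA` acts simply transitively on Magnus expansions. If `θ(xᵢ) = 1 + xᵢ + …`, the
substitution `xᵢ ↦ θ(xᵢ) - 1` is unipotent for the degree filtration, hence invertible, and it
carries the standard expansion to `θ`; uniqueness follows degree by degree. So there is exactly one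
transition map between any two expansions (`existsUnique_takes`), and transition maps compose
(`transition_trans`).

The series `ℓ` is natural, so `θ^{φ(G)} = |φ| ∘ θ^G ∘ φ⁻¹`. The total Johnson map of `φ` is
therefore the transition map between the expansions of the last and the first fatgraph, that is, the
composite `τ(W₁) ∘ ⋯ ∘ τ(W_k)`. First components add under composition. Second components add up to
the cross term `(U₁ ⊗ 1 + 1 ⊗ U₁) ∘ V₁` for `U ∘ V` (`component_two_trans`), so each `W_i` is paired
with the later `W_j`. On the second Torelli group the sum of all `τ₁(W_j)` vanishes, and the sum
over `j > i` becomes minus the sum over `j ≤ i`. On the Torelli group, total Johnson maps of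
different expansions are conjugate in `IA`, which does not affect a leading component; for the
standard expansion this component is Johnson's homomorphism.

The substantial point is that `θ^G` exists. First, the values `exp ℓ(x)` must satisfy the vertex
relations (`exp_ell_vertex`). Path sums are differences of a potential on the boundary cycle cut
open at the univalent vertex; around a vertex they add up to `-1/3` times three corner terms, each
of which equals, in the next degree, the defect of the vertex relation. So each step of the
recursion cancels the defect in one more degree.

Second, these values must extend to the fundamental group, although the marks are only assumed to
satisfy the relations and to generate (`exists_isMagnus_extension`). In each degree the discrepancy
is an odd function on oriented edges with sum zero at every trivalent vertex. A dimension count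
shows that such functions form a space of dimension at most `2g`, so that all of them come from
homology, and this forces the discrepancy to vanish. -/

namespace NCSeries

variable {ι : Type}

/-! # The degree filtration -/

@[simp] theorem coeff_homog (n : ℕ) (f : NCSeries ι) (w : List ι) :
    (homog n f).coeff w = if w.length = n then f.coeff w else 0 := rfl

@[simp] theorem coeff_tail (a : ι) (f : NCSeries ι) (w : List ι) :
    (tail a f).coeff w = f.coeff (a :: w) := rfl

@[simp] theorem coeff_ofH_nil (v : ι → ℚ) : (ofH v).coeff [] = 0 := rfl

@[simp] theorem coeff_ofH_singleton (v : ι → ℚ) (i : ι) : (ofH v).coeff [i] = v i := rfl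

@[simp] theorem coeff_ofH_cons_cons (v : ι → ℚ) (i j : ι) (w : List ι) :
    (ofH v).coeff (i :: j :: w) = 0 := rfl

@[simp] theorem coeff_sum {κ : Type*} (s : Finset κ) (f : κ → NCSeries ι) (w : List ι) :
    (∑ i ∈ s, f i).coeff w = ∑ i ∈ s, (f i).coeff w := by
  classical
  induction s using Finset.induction_on with
  | empty => simp
  | insert a s ha ih => rw [Finset.sum_insert ha, Finset.sum_insert ha, coeff_add, ih]

namespace InFil

variable {p q : ℕ} {f h : NCSeries ι}

theorem zero_fil (f : NCSeries ι) : InFil 0 f := fun _ hw => absurd hw (Nat.not_lt_zero _)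

theorem zero (p : ℕ) : InFil p (0 : NCSeries ι) := fun _ _ => rfl

theorem mono (hf : InFil p f) (hq : q ≤ p) : InFil q f := fun w hw => hf w (hw.trans_le hq)

theorem add (hf : InFil p f) (hh : InFil p h) : InFil p (f + h) := fun w hw => by
  simp [hf w hw, hh w hw]

theorem neg (hf : InFil p f) : InFil p (-f) := fun w hw => by simp [hf w hw]

theorem sub (hf : InFil p f) (hh : InFil p h) : InFil p (f - h) := fun w hw => by
  simp [hf w hw, hh w hw]

theorem sub_comm (hf : InFil p (f - h)) : InFil p (h - f) := by
  rw [← neg_sub]; exact hf.neg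

theorem sum {κ : Type*} {s : Finset κ} {F : κ → NCSeries ι} (hF : ∀ i ∈ s, InFil p (F i)) :
    InFil p (∑ i ∈ s, F i) := fun w hw => by
  rw [coeff_sum]
  exact Finset.sum_eq_zero fun i hi => hF i hi w hw

theorem mul (hf : InFil p f) (hh : InFil q h) : InFil (p + q) (f * h) := fun w hw => by
  rw [coeff_mul]
  refine Finset.sum_eq_zero fun i hi => ?_
  have hi' : i ≤ w.length := Nat.lt_succ_iff.1 (Finset.mem_range.1 hi)
  by_cases hip : i < p
  · rw [hf _ (by rw [List.length_take]; omega), zero_mul]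
  · rw [hh _ (by rw [List.length_drop]; omega), mul_zero]

theorem mul_left (h : NCSeries ι) (hf : InFil p f) : InFil p (h * f) := by
  have := (zero_fil h).mul hf
  rwa [zero_add] at this

theorem mul_right (h : NCSeries ι) (hf : InFil p f) : InFil p (f * h) := hf.mul (zero_fil h)

theorem pow (hf : InFil 1 f) (n : ℕ) : InFil n (f ^ n) := by
  induction n with
  | zero => exact zero_fil _
  | succ n ih => rw [pow_succ]; exact ih.mul hf

theorem eq_zero (hf : ∀ p, InFil p f) : f = 0 := by
  ext w
  exact hf (w.length + 1) w (Nat.lt_succ_self _)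

theorem ext_of_sub (hf : ∀ p, InFil p (f - h)) : f = h := sub_eq_zero.1 (eq_zero hf)

theorem trans {k : NCSeries ι} (h₁ : InFil p (f - h)) (h₂ : InFil p (h - k)) :
    InFil p (f - k) := by
  rw [← sub_add_sub_cancel f h k]; exact h₁.add h₂

theorem mul_sub_mul {f' h' : NCSeries ι} (hf : InFil p (f - f')) (hh : InFil p (h - h')) :
    InFil p (f * h - f' * h') := by
  have e : f * h - f' * h' = (f - f') * h + f' * (h - h') := by noncomm_ring
  rw [e]
  exact (hf.mul_right h).add (hh.mul_left f')

theorem pow_sub_pow (hf : InFil p (f - h)) (n : ℕ) : InFil p (f ^ n - h ^ n) := by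
  induction n with
  | zero => simpa using zero p
  | succ n ih => rw [pow_succ, pow_succ]; exact ih.mul_sub_mul hf

theorem tail (a : ι) (hf : InFil (p + 1) f) : InFil p (NCSeries.tail a f) := fun w hw =>
  hf (a :: w) (by simpa using hw)

theorem coeff_eq (hf : InFil p (f - h)) {w : List ι} (hw : w.length < p) :
    f.coeff w = h.coeff w := by
  simpa [sub_eq_zero] using hf w hw

theorem homog_eq_zero (hf : InFil p f) (hq : q < p) : homog q f = 0 := by
  ext w
  by_cases hw : w.length = q
  · simp [hw, hf w (by omega)]
  · simp [hw]

theorem homog_eq (hf : InFil p (f - h)) (hq : q < p) : homog q f = homog q h := by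
  rw [← sub_eq_zero, ← map_sub, hf.homog_eq_zero hq]

theorem sub_homog (hf : InFil p f) : InFil (p + 1) (f - homog p f) := fun w hw => by
  rcases Nat.lt_succ_iff_lt_or_eq.1 hw with h | h
  · simp [hf w h]
  · simp [h]

/-- Of all the cuts of a word of length `p + q`, only the one after `p` letters avoids the vanishing
low-degree part of both factors. -/
theorem homog_mul (hf : InFil p f) (hh : InFil q h) :
    homog (p + q) (f * h) = homog p f * homog q h := by
  ext w
  rw [coeff_homog]
  split_ifs with hw
  · rw [coeff_mul, coeff_mul]
    refine Finset.sum_congr rfl fun i hi => ?_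
    have hi' : i ≤ w.length := Nat.lt_succ_iff.1 (Finset.mem_range.1 hi)
    rcases lt_trichotomy i p with h | h | h
    · rw [hf (w.take i) (by rw [List.length_take]; omega), coeff_homog, if_neg, zero_mul, zero_mul]
      rw [List.length_take]; omega
    · rw [coeff_homog, coeff_homog, if_pos, if_pos]
      · rw [List.length_drop]; omega
      · rw [List.length_take]; omega
    · rw [hh (w.drop i) (by rw [List.length_drop]; omega), coeff_homog q, if_neg, mul_zero,
        mul_zero]
      rw [List.length_drop]; omega
  · rw [coeff_mul]
    refine (Finset.sum_eq_zero fun i hi => ?_).symm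
    have hi' : i ≤ w.length := Nat.lt_succ_iff.1 (Finset.mem_range.1 hi)
    rw [coeff_homog, coeff_homog]
    by_cases h : i = p
    · rw [if_neg (show ¬ (w.drop i).length = q by rw [List.length_drop]; omega), mul_zero]
    · rw [if_neg (show ¬ (w.take i).length = p by rw [List.length_take]; omega), zero_mul]

end InFil

theorem inFil_homog (n : ℕ) (f : NCSeries ι) : InFil n (homog n f) := fun w hw => by
  simp [hw.ne]

theorem inFil_one_iff {f : NCSeries ι} : InFil 1 f ↔ f.coeff [] = 0 := by
  refine ⟨fun h => h [] Nat.zero_lt_one, fun h w hw => ?_⟩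
  rw [List.length_eq_zero_iff.1 (Nat.lt_one_iff.1 hw), h]

theorem inFil_two_iff {f : NCSeries ι} :
    InFil 2 f ↔ f.coeff [] = 0 ∧ ∀ i, f.coeff [i] = 0 := by
  refine ⟨fun h => ⟨h [] Nat.zero_lt_two, fun i => h [i] Nat.one_lt_two⟩, fun h w hw => ?_⟩
  rcases w with _ | ⟨a, _ | ⟨b, w⟩⟩
  · exact h.1
  · exact h.2 a
  · simp at hw

theorem inFil_ofH (v : ι → ℚ) : InFil 1 (ofH v) := inFil_one_iff.2 rfl

@[simp] theorem homog_one_ofH (v : ι → ℚ) : homog 1 (ofH v) = ofH v := by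
  ext w
  rcases w with _ | ⟨a, _ | ⟨b, w⟩⟩ <;> simp

theorem homog_ofH {n : ℕ} (hn : n ≠ 1) (v : ι → ℚ) : homog n (ofH v) = 0 := by
  ext w
  rcases w with _ | ⟨a, _ | ⟨b, w⟩⟩ <;> simp [hn.symm]

theorem homog_one {n : ℕ} (hn : n ≠ 0) : homog n (1 : NCSeries ι) = 0 := by
  ext w
  rcases w with _ | ⟨a, w⟩ <;> simp [hn.symm]

theorem homog_homog_of_ne {m n : ℕ} (h : m ≠ n) (f : NCSeries ι) :
    homog m (homog n f) = 0 := by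
  ext w
  simp +contextual [h]

section Tail

@[simp] theorem tail_add (a : ι) (f h : NCSeries ι) : tail a (f + h) = tail a f + tail a h := rfl

@[simp] theorem tail_smul (a : ι) (c : ℚ) (f : NCSeries ι) : tail a (c • f) = c • tail a f := rfl

theorem tail_mul (a : ι) (f h : NCSeries ι) :
    tail a (f * h) = f.coeff [] • tail a h + tail a f * h := by
  ext w
  exact coeff_mul_cons f h a w

theorem tail_one (a : ι) : tail a (1 : NCSeries ι) = 0 := rfl

theorem tail_ofH' (a : ι) (v : ι → ℚ) : tail a (ofH v) = v a • (1 : NCSeries ι) := by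
  ext w
  cases w <;> simp

variable [Fintype ι] [DecidableEq ι]

/-- Splitting off the first letter is what makes inductions on the degree possible without
manipulating words. -/
theorem eq_sum_tail (f : NCSeries ι) :
    f = f.coeff [] • 1 + ∑ i, ofH (Pi.single i 1) * tail i f := by
  ext w
  rcases w with _ | ⟨a, w⟩
  · simp
  · simp only [coeff_add, coeff_smul, coeff_one_cons, mul_zero, zero_add, coeff_sum,
      coeff_mul_cons, coeff_ofH_nil, zero_mul, tail_ofH', Algebra.smul_mul_assoc, one_mul,
      coeff_tail]
    simp [Pi.single_apply]

theorem eq_sum_tail_of_inFil_one {f : NCSeries ι} (hf : InFil 1 f) :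
    f = ∑ i, ofH (Pi.single i 1) * tail i f := by
  conv_lhs => rw [eq_sum_tail f, inFil_one_iff.1 hf, zero_smul, zero_add]

theorem ofH_eq_sum (v : ι → ℚ) : ofH v = ∑ i, v i • ofH (Pi.single i 1) := by
  conv_lhs => rw [pi_eq_sum_univ' v, map_sum]
  simp only [map_smul]

end Tail

end NCSeries
namespace NCSeries

variable {ι : Type}

/-! # Exponential and logarithm -/

/-- The value of a power series in one variable at a series without constant term. -/
noncomputable def evalPS (X : NCSeries ι) (f : PowerSeries ℚ) : NCSeries ι :=
  ⟨fun w => ∑ n ∈ Finset.range (w.length + 1), PowerSeries.coeff n f * (X ^ n).coeff w⟩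

theorem coeff_evalPS {X : NCSeries ι} (hX : InFil 1 X) (f : PowerSeries ℚ) (w : List ι) {N : ℕ}
    (hN : w.length < N) :
    (evalPS X f).coeff w = ∑ n ∈ Finset.range N, PowerSeries.coeff n f * (X ^ n).coeff w := by
  simp only [evalPS]
  refine Finset.sum_subset (fun n hn => ?_) fun n _ hn => ?_
  · rw [Finset.mem_range] at *; omega
  · rw [hX.pow n w (by rw [Finset.mem_range] at hn; omega), mul_zero]

/-- Modulo degree `N` only the first `N` powers of `X` survive. Identities between power series can
thus be transferred from polynomials, where evaluation is known to be multiplicative. -/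
theorem evalPS_sub_aeval {X : NCSeries ι} (hX : InFil 1 X) (f : PowerSeries ℚ) (N : ℕ)
    (P : Polynomial ℚ) (hP : ∀ n < N, P.coeff n = PowerSeries.coeff n f) :
    InFil N (evalPS X f - Polynomial.aeval X P) := by
  intro w hw
  have hle : N ≤ max N (P.natDegree + 1) := le_max_left _ _
  rw [coeff_sub, coeff_evalPS hX f w (hw.trans_le hle),
    Polynomial.aeval_eq_sum_range' (n := max N (P.natDegree + 1)) (by omega), coeff_sum,
    ← Finset.sum_sub_distrib]
  refine Finset.sum_eq_zero fun n _ => ?_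
  rw [coeff_smul, ← sub_mul]
  by_cases h : n < N
  · rw [hP n h, sub_self, zero_mul]
  · rw [hX.pow n w (by omega), mul_zero]

theorem evalPS_mul {X : NCSeries ι} (hX : InFil 1 X) (f h : PowerSeries ℚ) :
    evalPS X (f * h) = evalPS X f * evalPS X h := by
  refine InFil.ext_of_sub fun N => ?_
  have hf := evalPS_sub_aeval hX f N (PowerSeries.trunc N f) fun n hn => by
    rw [PowerSeries.coeff_trunc, if_pos hn]
  have hh := evalPS_sub_aeval hX h N (PowerSeries.trunc N h) fun n hn => by
    rw [PowerSeries.coeff_trunc, if_pos hn]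
  have hfh := evalPS_sub_aeval hX (f * h) N (PowerSeries.trunc N f * PowerSeries.trunc N h)
    fun n hn => by
      rw [Polynomial.coeff_mul, PowerSeries.coeff_mul]
      refine Finset.sum_congr rfl fun ij hij => ?_
      rw [Finset.HasAntidiagonal.mem_antidiagonal] at hij
      rw [PowerSeries.coeff_trunc, PowerSeries.coeff_trunc, if_pos (by omega), if_pos (by omega)]
  rw [map_mul] at hfh
  exact hfh.trans (hf.mul_sub_mul hh).sub_comm

theorem evalPS_one (X : NCSeries ι) : evalPS X 1 = 1 := by
  ext w
  simp [evalPS, PowerSeries.coeff_one]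

theorem evalPS_sub (X : NCSeries ι) (f h : PowerSeries ℚ) :
    evalPS X (f - h) = evalPS X f - evalPS X h := by
  ext w
  simp [evalPS, sub_mul]

theorem evalPS_pow {X : NCSeries ι} (hX : InFil 1 X) (f : PowerSeries ℚ) (n : ℕ) :
    evalPS X (f ^ n) = evalPS X f ^ n := by
  induction n with
  | zero => simp [evalPS_one]
  | succ n ih => rw [pow_succ, pow_succ, evalPS_mul hX, ih]

theorem evalPS_exp (X : NCSeries ι) : evalPS X (PowerSeries.exp ℚ) = exp X := by
  ext w
  simp [evalPS, exp, PowerSeries.coeff_exp]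

theorem evalPS_evalNegHom_exp (X : NCSeries ι) :
    evalPS X (PowerSeries.evalNegHom (PowerSeries.exp ℚ)) = exp (-X) := by
  ext w
  simp only [evalPS, exp]
  refine Finset.sum_congr rfl fun n _ => ?_
  rw [PowerSeries.evalNegHom, PowerSeries.coeff_rescale, PowerSeries.coeff_exp, neg_pow X]
  have e : ((-1 : NCSeries ι) ^ n) = ((-1 : ℚ) ^ n) • 1 := by
    rcases neg_one_pow_eq_or ℤ n with h | h
    · rcases Nat.even_or_odd n with h | h <;> simp [h.neg_one_pow]
    · rcases Nat.even_or_odd n with h | h <;> simp [h.neg_one_pow]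
  rw [e, smul_mul_assoc, one_mul, coeff_smul]
  simp
  ring

theorem exp_mul_exp_neg {X : NCSeries ι} (hX : InFil 1 X) : exp X * exp (-X) = 1 := by
  rw [← evalPS_exp, ← evalPS_evalNegHom_exp, ← evalPS_mul hX,
    PowerSeries.exp_mul_exp_neg_eq_one, evalPS_one]

theorem exp_neg_mul_exp {X : NCSeries ι} (hX : InFil 1 X) : exp (-X) * exp X = 1 := by
  have := exp_mul_exp_neg hX.neg
  rwa [neg_neg] at this

/-- Both sides have zero constant term, and both have derivative `1`: the derivative of `log (1 +
T)` is the inverse of `1 + T`, which becomes the inverse of `exp` after substitution. -/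
theorem _root_.PowerSeries.log_subst_exp_sub_one :
    (PowerSeries.log ℚ).subst (PowerSeries.exp ℚ - 1) = (PowerSeries.X : PowerSeries ℚ) := by
  have hs : PowerSeries.HasSubst (PowerSeries.exp ℚ - 1) := PowerSeries.HasSubst.exp_sub_one
  apply PowerSeries.derivative.ext
  · rw [PowerSeries.derivative_subst hs, PowerSeries.deriv_log]
    have h1 : (PowerSeries.mk fun n ↦ algebraMap ℚ ℚ ((-1 : ℚ) ^ n)) * (1 + PowerSeries.X) = 1 := by
      ext n
      rw [mul_add, mul_one]
      rcases n with _ | n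
      · simp
      · simp [PowerSeries.coeff_succ_mul_X, PowerSeries.coeff_one, pow_succ]
    have h2 := congrArg (PowerSeries.subst (PowerSeries.exp ℚ - 1)) h1
    rw [PowerSeries.subst_mul hs, PowerSeries.subst_add hs, PowerSeries.subst_X hs] at h2
    have h3 : PowerSeries.subst (PowerSeries.exp ℚ - 1) (1 : PowerSeries ℚ) = (1 : PowerSeries ℚ) := by
      rw [← PowerSeries.coe_substAlgHom hs, map_one]
    rw [h3, add_sub_cancel] at h2
    rw [map_sub, PowerSeries.derivative_exp]
    simpa using h2
  · rw [PowerSeries.constantCoeff_X]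
    exact PowerSeries.constantCoeff_subst_eq_zero (by
      change PowerSeries.constantCoeff (PowerSeries.exp ℚ - 1) = 0
      simp) _ PowerSeries.constantCoeff_log

theorem log_exp {X : NCSeries ι} (hX : InFil 1 X) : log (exp X) = X := by
  have hs : PowerSeries.HasSubst (PowerSeries.exp ℚ - 1) := PowerSeries.HasSubst.exp_sub_one
  -- The order of the `k`-th power is at least `k`, so the terms with `k ≤ |w|` already account for
  -- every coefficient of index `n ≤ |w|` of the composite series.
  have hc : ∀ n k, n < k → PowerSeries.coeff n ((PowerSeries.exp ℚ - 1) ^ k) = 0 := fun n k h =>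
    PowerSeries.coeff_of_lt_order _ <| by
      refine lt_of_lt_of_le (by exact_mod_cast h)
        (PowerSeries.le_order_pow_of_constantCoeff_eq_zero k ?_)
      simp
  ext w
  have h1 : ∀ k, (exp X - 1) ^ k = evalPS X ((PowerSeries.exp ℚ - 1) ^ k) := fun k => by
    rw [evalPS_pow hX, evalPS_sub, evalPS_one, evalPS_exp]
  simp only [log, h1]
  simp only [evalPS, Finset.mul_sum]
  rw [Finset.sum_comm]
  have h2 : ∀ n ∈ Finset.range (w.length + 1), ∑ k ∈ Finset.Icc 1 w.length,
      (-1 : ℚ) ^ (k + 1) / k * (PowerSeries.coeff n ((PowerSeries.exp ℚ - 1) ^ k) * (X ^ n).coeff w)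
      = PowerSeries.coeff n (PowerSeries.X : PowerSeries ℚ) * (X ^ n).coeff w := by
    intro n hn
    simp only [← mul_assoc]
    rw [← Finset.sum_mul, ← PowerSeries.log_subst_exp_sub_one, PowerSeries.coeff_subst' hs]
    congr 1
    rw [finsum_eq_sum_of_support_subset (s := Finset.Icc 1 w.length)]
    · refine Finset.sum_congr rfl fun k hk => ?_
      simp [PowerSeries.coeff_log]
      have : k ≠ 0 := by rw [Finset.mem_Icc] at hk; omega
      simp [this]
    · intro k hk
      rw [Finset.coe_Icc, Set.mem_Icc]
      rw [Finset.mem_range] at hn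
      by_contra hcon
      apply hk
      by_cases h0 : k = 0
      · simp [h0, PowerSeries.coeff_log]
      · simp only []
        rw [hc n k (by omega), smul_zero]
  rw [Finset.sum_congr rfl h2]
  simp only [PowerSeries.coeff_X, ite_mul, one_mul, zero_mul, Finset.sum_ite_eq',
    Finset.mem_range, Nat.lt_succ_iff, pow_one]
  split_ifs with h
  · rfl
  · exact (hX w (by omega)).symm

theorem InFil.log_sub_log {p : ℕ} {f h : NCSeries ι} (H : InFil p (f - h)) :
    InFil p (log f - log h) := fun w hw => by
  rw [coeff_sub, sub_eq_zero]
  simp only [log]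
  have H' : InFil p (f - 1 - (h - 1)) := by rwa [sub_sub_sub_cancel_right]
  refine Finset.sum_congr rfl fun n _ => ?_
  rw [(H'.pow_sub_pow n).coeff_eq hw]

theorem InFil.exp_sub_exp {p : ℕ} {f h : NCSeries ι} (H : InFil p (f - h)) :
    InFil p (exp f - exp h) := fun w hw => by
  rw [coeff_sub, sub_eq_zero]
  simp only [exp]
  refine Finset.sum_congr rfl fun n _ => ?_
  rw [(H.pow_sub_pow n).coeff_eq hw]

theorem exp_zero : exp (0 : NCSeries ι) = 1 := by
  rw [← exp_mul_exp_neg (InFil.zero 1), neg_zero]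
  have h : exp (0 : NCSeries ι) = 1 := by
    ext w
    simp [exp, Finset.sum_range_succ']
  rw [h, one_mul]

theorem inFil_exp_sub_one {X : NCSeries ι} (hX : InFil 1 X) : InFil 1 (exp X - 1) := by
  rw [← exp_zero]
  exact InFil.exp_sub_exp (by simpa using hX)

/-- Adding a term of high degree to the exponent changes the exponential by that term only,
modulo still higher degrees. -/
theorem inFil_exp_add {p : ℕ} {X D : NCSeries ι} (hX : InFil 1 X) (hD : InFil (p + 1) D) :
    InFil (p + 2) (exp (X + D) - (exp X + D)) := by
  have hXD : InFil 1 (X + D) := hX.add (hD.mono (by omega))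
  -- In powers with exponent at least two, each occurrence of `D` comes with another factor of
  -- positive degree.
  have key : ∀ n, InFil (p + 2) ((X + D) ^ (n + 2) - X ^ (n + 2)) := by
    intro n
    induction n with
    | zero =>
      have e : (X + D) ^ 2 - X ^ 2 = (X + D) * D + D * X := by noncomm_ring
      rw [zero_add, e]
      exact ((hXD.mul hD).mono (by omega)).add ((hD.mul hX).mono (by omega))
    | succ n ih =>
      have e : (X + D) ^ (n + 3) - X ^ (n + 3) =
          ((X + D) ^ (n + 2) - X ^ (n + 2)) * (X + D) + X ^ (n + 2) * D := by
        rw [pow_succ (X + D) (n + 2), pow_succ X (n + 2)]; noncomm_ring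
      rw [e]
      exact (ih.mul_right _).add (((hX.pow (n + 2)).mul hD).mono (by omega))
  -- The constant and linear terms are split off. The truncated `w.length - 1` is `0` for words of
  -- length at most one, where no higher power contributes; the empty word does not see the linear
  -- term either.
  have hps : ∀ Y : NCSeries ι, ∀ w : List ι, (exp Y).coeff w =
      (1 : NCSeries ι).coeff w + (if 0 < w.length then Y.coeff w else 0) +
        ∑ n ∈ Finset.range (w.length - 1), ((n + 2).factorial : ℚ)⁻¹ * (Y ^ (n + 2)).coeff w := by
    intro Y w
    rcases w with _ | ⟨a, w⟩
    · simp [exp]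
    · simp only [exp, List.length_cons]
      rw [Finset.sum_range_succ', Finset.sum_range_succ']
      simp
      ring
  intro w hw
  simp only [coeff_sub, coeff_add]
  rw [hps, hps]
  have hs : ∑ n ∈ Finset.range (w.length - 1),
      ((n + 2).factorial : ℚ)⁻¹ * ((X + D) ^ (n + 2)).coeff w =
      ∑ n ∈ Finset.range (w.length - 1), ((n + 2).factorial : ℚ)⁻¹ * (X ^ (n + 2)).coeff w :=
    Finset.sum_congr rfl fun n _ => by rw [(key n).coeff_eq hw]
  rw [hs]
  split_ifs with h
  · rw [coeff_add]; ring
  · rw [hD w (by omega)]; ring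

end NCSeries
namespace NCSeries

variable {ι : Type}

/-! # Endomorphisms and the group `IA` -/

section Fintype

variable [Fintype ι]

/-- Approximations of the substitution of `a i` for the variable `i`. -/
noncomputable def substTrunc (a : ι → NCSeries ι) : ℕ → NCSeries ι → NCSeries ι
  | 0, _ => 0
  | n + 1, f => f.coeff [] • 1 + ∑ i, a i * substTrunc a n (tail i f)

/-- The substitution of `a i` (a series without constant term) for the variable `i`. -/
noncomputable def subst (a : ι → NCSeries ι) (f : NCSeries ι) : NCSeries ι :=
  ⟨fun w => (substTrunc a (w.length + 1) f).coeff w⟩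

section Subst

variable {a : ι → NCSeries ι}

theorem substTrunc_succ_sub (ha : ∀ i, InFil 1 (a i)) (n : ℕ) (f : NCSeries ι) :
    InFil n (substTrunc a (n + 1) f - substTrunc a n f) := by
  induction n generalizing f with
  | zero => exact InFil.zero_fil _
  | succ n ih =>
    rw [substTrunc, substTrunc, add_sub_add_left_eq_sub, ← Finset.sum_sub_distrib]
    refine InFil.sum fun i _ => ?_
    rw [← mul_sub]
    exact ((ha i).mul (ih _)).mono (by omega)

theorem substTrunc_sub (ha : ∀ i, InFil 1 (a i)) {m n : ℕ} (h : n ≤ m) (f : NCSeries ι) :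
    InFil n (substTrunc a m f - substTrunc a n f) := by
  induction m, h using Nat.le_induction with
  | base => simpa using InFil.zero n
  | succ m hm ih => exact ((substTrunc_succ_sub ha m f).mono hm).trans ih

theorem subst_sub_substTrunc (ha : ∀ i, InFil 1 (a i)) (n : ℕ) (f : NCSeries ι) :
    InFil n (subst a f - substTrunc a n f) := fun w hw => by
  rw [coeff_sub, sub_eq_zero]
  exact ((substTrunc_sub ha (Nat.succ_le_of_lt hw) f).coeff_eq (Nat.lt_succ_self _)).symm

theorem substTrunc_add (a : ι → NCSeries ι) (n : ℕ) (f h : NCSeries ι) :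
    substTrunc a n (f + h) = substTrunc a n f + substTrunc a n h := by
  induction n generalizing f h with
  | zero => simp [substTrunc]
  | succ n ih =>
    simp only [substTrunc, coeff_add, tail_add, ih, mul_add, Finset.sum_add_distrib, add_smul]
    abel

theorem substTrunc_smul (a : ι → NCSeries ι) (n : ℕ) (c : ℚ) (f : NCSeries ι) :
    substTrunc a n (c • f) = c • substTrunc a n f := by
  induction n generalizing f with
  | zero => simp [substTrunc]
  | succ n ih =>
    simp only [substTrunc, coeff_smul, tail_smul, ih, mul_smul_comm, smul_add, Finset.smul_sum,
      mul_smul]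

/-- The recursion lowers the level on the left factor only, so the right factor is left one level
too high. That error lies in degree `n`, and the factor `a i` in front raises it to degree `n + 1`.
-/
theorem substTrunc_mul (ha : ∀ i, InFil 1 (a i)) (n : ℕ) (f h : NCSeries ι) :
    InFil n (substTrunc a n (f * h) - substTrunc a n f * substTrunc a n h) := by
  induction n generalizing f h with
  | zero => exact InFil.zero_fil _
  | succ n ih =>
    have e : substTrunc a (n + 1) (f * h) - substTrunc a (n + 1) f * substTrunc a (n + 1) h =
        ∑ i, a i * ((substTrunc a n (tail i f * h) -
          substTrunc a n (tail i f) * substTrunc a n h) -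
          substTrunc a n (tail i f) * (substTrunc a (n + 1) h - substTrunc a n h)) := by
      have e1 : substTrunc a (n + 1) (f * h) = f.coeff [] • substTrunc a (n + 1) h +
          ∑ i, a i * substTrunc a n (tail i f * h) := by
        simp only [substTrunc, tail_mul, coeff_mul_nil, substTrunc_add, substTrunc_smul,
          mul_add, Finset.sum_add_distrib, mul_smul_comm, smul_add, Finset.smul_sum, mul_smul]
        abel
      have e2 : substTrunc a (n + 1) f * substTrunc a (n + 1) h =
          f.coeff [] • substTrunc a (n + 1) h +
            ∑ i, a i * (substTrunc a n (tail i f) * substTrunc a (n + 1) h) := by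
        rw [show substTrunc a (n + 1) f = f.coeff [] • 1 + ∑ i, a i * substTrunc a n (tail i f)
          from rfl]
        simp only [add_mul, smul_mul_assoc, one_mul, Finset.sum_mul, mul_assoc]
      rw [e1, e2, add_sub_add_left_eq_sub, ← Finset.sum_sub_distrib]
      refine Finset.sum_congr rfl fun i _ => ?_
      noncomm_ring
    rw [e]
    refine InFil.sum fun i _ => ((ha i).mul ((ih _ _).sub
      ((substTrunc_succ_sub ha n h).mul_left _))).mono (by omega)

theorem subst_mul (ha : ∀ i, InFil 1 (a i)) (f h : NCSeries ι) :
    subst a (f * h) = subst a f * subst a h :=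
  InFil.ext_of_sub fun n => ((subst_sub_substTrunc ha n _).trans (substTrunc_mul ha n f h)).trans
    ((subst_sub_substTrunc ha n f).mul_sub_mul (subst_sub_substTrunc ha n h)).sub_comm

theorem subst_one (a : ι → NCSeries ι) : subst a 1 = 1 := by
  have h0 : ∀ n, substTrunc a n 0 = 0 := fun n => by
    have := substTrunc_smul a n 0 0
    rwa [zero_smul, zero_smul] at this
  ext w
  simp [subst, substTrunc, tail_one, h0]

/-- Substitution, as a homomorphism of algebras. -/
noncomputable def substAlgHom (ha : ∀ i, InFil 1 (a i)) : NCSeries ι →ₐ[ℚ] NCSeries ι :=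
  AlgHom.ofLinearMap
    { toFun := subst a
      map_add' := fun f h => by
        ext w
        simp [subst, substTrunc_add]
      map_smul' := fun c f => by
        ext w
        simp [subst, substTrunc_smul] }
    (subst_one a) (subst_mul ha)

theorem substAlgHom_ofH [DecidableEq ι] (ha : ∀ i, InFil 1 (a i)) (i : ι) :
    substAlgHom ha (ofH (Pi.single i 1)) = a i := by
  refine InFil.ext_of_sub fun n => ((subst_sub_substTrunc ha (n + 2) _).mono (by omega)).trans ?_
  have h0 : substTrunc a (n + 1) 1 = 1 := by
    have h0 : substTrunc a n 0 = 0 := by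
      have := substTrunc_smul a n 0 0
      rwa [zero_smul, zero_smul] at this
    simp [substTrunc, tail_one, h0]
  have : substTrunc a (n + 2) (ofH (Pi.single i 1)) = a i := by
    rw [substTrunc]
    simp only [coeff_ofH_nil, zero_smul, zero_add, tail_ofH', substTrunc_smul, h0]
    simp [Pi.single_apply]
  rw [this, sub_self]
  exact InFil.zero n

end Subst

/-- An algebra homomorphism that is unipotent on the variables is unipotent with respect to the
degree filtration. -/
theorem inFil_map_sub [DecidableEq ι] {A : NCSeries ι →ₐ[ℚ] NCSeries ι}
    (hA : ∀ i, InFil 2 (A (ofH (Pi.single i 1)) - ofH (Pi.single i 1)))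
    (p : ℕ) {f : NCSeries ι} (hf : InFil p f) : InFil (p + 1) (A f - f) := by
  induction p generalizing f with
  | zero =>
    have hX : ∀ i, InFil 1 (A (ofH (Pi.single i 1))) := fun i => by
      have := ((hA i).mono one_le_two).add (inFil_ofH (Pi.single i 1))
      rwa [sub_add_cancel] at this
    have e : A f - f = ∑ i, (A (ofH (Pi.single i 1)) * A (tail i f) -
        ofH (Pi.single i 1) * tail i f) := by
      conv_lhs => rw [eq_sum_tail f]
      simp [map_add, map_sum, Finset.sum_sub_distrib]
    rw [e]
    exact InFil.sum fun i _ => ((hX i).mul_right _).sub ((inFil_ofH _).mul_right _)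
  | succ p ih =>
    -- Twisted Leibniz rule: the first summand gains a degree from the variable, the second from the
    -- inductive hypothesis for the tail.
    have e : A f - f = ∑ i, ((A (ofH (Pi.single i 1)) - ofH (Pi.single i 1)) * A (tail i f) +
        ofH (Pi.single i 1) * (A (tail i f) - tail i f)) := by
      conv_lhs => rw [eq_sum_tail_of_inFil_one (hf.mono (by omega))]
      rw [map_sum, ← Finset.sum_sub_distrib]
      refine Finset.sum_congr rfl fun i _ => ?_
      rw [map_mul]
      noncomm_ring
    rw [e]
    refine InFil.sum fun i _ => ?_
    have h1 := ih (hf.tail i)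
    have h2 : InFil p (A (tail i f)) := by
      have := (h1.mono (Nat.le_succ p)).add (hf.tail i)
      rwa [sub_add_cancel] at this
    exact (((hA i).mul h2).mono (by omega)).add (((inFil_ofH _).mul h1).mono (by omega))

end Fintype

section Unipotent

variable {A : NCSeries ι →ₗ[ℚ] NCSeries ι}

theorem inFil_map_iff_of_unipotent
    (hA : ∀ p f, InFil p f → InFil (p + 1) (A f - f)) (p : ℕ) (f : NCSeries ι) :
    InFil p (A f) ↔ InFil p f := by
  constructor
  · intro h
    have : ∀ q ≤ p, InFil q f := by
      intro q hq
      induction q with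
      | zero => exact InFil.zero_fil _
      | succ q ih =>
        have h1 := (h.mono hq).sub (hA q f (ih (by omega)))
        rwa [sub_sub_cancel] at h1
    exact this p le_rfl
  · intro h
    have h1 := ((hA p f h).mono (Nat.le_succ p)).add h
    rwa [sub_add_cancel] at h1

/-- The operator `N = 1 - A` raises the degree, so the Neumann series `∑ N ^ k` converges and
inverts `A`. -/
theorem bijective_of_unipotent
    (hA : ∀ p f, InFil p f → InFil (p + 1) (A f - f)) : Function.Bijective A := by
  let N : Module.End ℚ (NCSeries ι) := LinearMap.id - A
  have hN : ∀ n f, InFil n ((N ^ n) f) := by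
    intro n f
    induction n with
    | zero => exact InFil.zero_fil _
    | succ n ih =>
      rw [pow_succ', Module.End.mul_apply, show ∀ f, N f = f - A f from fun _ => rfl]
      exact (hA n _ ih).sub_comm
  have hsum : ∀ n f, A (∑ k ∈ Finset.range n, (N ^ k) f) =
      f - (N ^ n) f := by
    intro n f
    induction n with
    | zero => simp
    | succ n ih =>
      rw [Finset.sum_range_succ, map_add, ih, pow_succ' _ n, Module.End.mul_apply,
        show ∀ f, N f = f - A f from fun _ => rfl]
      abel
  constructor
  · rw [injective_iff_map_eq_zero]
    intro f hf
    refine InFil.eq_zero fun p => ?_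
    rw [← inFil_map_iff_of_unipotent hA, hf]
    exact InFil.zero p
  · intro f
    -- The limit of the Neumann sums: the coefficient of `w` no longer changes once `k` exceeds
    -- `|w|`.
    let s : NCSeries ι :=
      ⟨fun w => (∑ k ∈ Finset.range (w.length + 1), (N ^ k) f).coeff w⟩
    refine ⟨s, InFil.ext_of_sub fun n => ?_⟩
    have hs : InFil n (s - ∑ k ∈ Finset.range n, (N ^ k) f) := by
      intro w hw
      rw [coeff_sub, sub_eq_zero, coeff_sum]
      simp only [coeff_sum]
      refine Finset.sum_subset (fun k hk => ?_) fun k _ hk => ?_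
      · rw [Finset.mem_range] at *; omega
      · exact hN k f w (by rw [Finset.mem_range] at hk; omega)
    have h1 := (inFil_map_iff_of_unipotent hA n _).2 hs
    rw [map_sub, hsum] at h1
    have h2 := h1.sub (hN n f)
    rwa [← sub_add, add_sub_cancel_right] at h2

end Unipotent

namespace IsIA

variable {U V : NCSeries ι ≃ₐ[ℚ] NCSeries ι}

theorem of_unipotent (hU : ∀ p f, InFil p f → InFil (p + 1) (U f - f)) : IsIA U :=
  ⟨inFil_map_iff_of_unipotent (A := U.toLinearMap) hU, fun f hf => hU 1 f hf⟩

theorem refl : IsIA (AlgEquiv.refl : NCSeries ι ≃ₐ[ℚ] NCSeries ι) :=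
  ⟨fun _ _ => Iff.rfl, fun f _ => by simpa using InFil.zero 2⟩

theorem symm (hU : IsIA U) : IsIA U.symm := by
  have h1 : ∀ p f, InFil p (U.symm f) ↔ InFil p f := fun p f => by
    rw [← hU.1, AlgEquiv.apply_symm_apply]
  refine ⟨h1, fun f hf => ?_⟩
  have := (hU.2 _ ((h1 1 f).2 hf)).sub_comm
  rwa [AlgEquiv.apply_symm_apply] at this

theorem trans (hU : IsIA U) (hV : IsIA V) : IsIA (U.trans V) := by
  refine ⟨fun p f => by rw [AlgEquiv.trans_apply, hV.1, hU.1], fun f hf => ?_⟩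
  exact (hV.2 _ ((hU.1 1 f).2 hf)).trans (hU.2 f hf)

variable [Fintype ι] [DecidableEq ι]

theorem inFil_sub (hU : IsIA U) {p : ℕ} {f : NCSeries ι} (hf : InFil p f) :
    InFil (p + 1) (U f - f) :=
  inFil_map_sub (A := U.toAlgHom) (fun _ => hU.2 _ (inFil_ofH _)) p hf

end IsIA

theorem component_apply [Fintype ι] [DecidableEq ι] (m : ℕ) (U : NCSeries ι ≃ₐ[ℚ] NCSeries ι)
    (v : ι → ℚ) : component m U v = homog (m + 1) (U (ofH v)) := rfl

theorem component_refl {m : ℕ} (hm : m ≠ 0) :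
    component m (AlgEquiv.refl : NCSeries ι ≃ₐ[ℚ] NCSeries ι) = 0 := by
  refine LinearMap.ext fun v => ?_
  exact homog_ofH (by omega) v

/-! ### First and second components under composition and conjugation -/

section Component

variable [Fintype ι] [DecidableEq ι] {U V : NCSeries ι ≃ₐ[ℚ] NCSeries ι}

theorem component_eq_homog_sub {m : ℕ} (hm : m ≠ 0) (v : ι → ℚ) :
    component m U v = homog (m + 1) (U (ofH v) - ofH v) := by
  rw [component_apply, map_sub, homog_ofH (by omega) v, sub_zero]

/-- `V.trans U` is `U ∘ V`, and `(U - 1)(V - 1)` raises degree one to degree three, so it is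
invisible in degree two. -/
theorem component_one_trans (hU : IsIA U) (hV : IsIA V) :
    component 1 (V.trans U) = component 1 U + component 1 V := by
  refine LinearMap.ext fun v => ?_
  rw [LinearMap.add_apply, component_apply, component_apply, AlgEquiv.trans_apply,
    component_eq_homog_sub one_ne_zero]
  have h := (hU.inFil_sub (hV.2 _ (inFil_ofH v))).homog_eq (q := 2) (by omega)
  rw [map_sub U, map_sub, sub_eq_iff_eq_add] at h
  rw [h, add_comm]

theorem deriv2_apply (f : (ι → ℚ) →ₗ[ℚ] NCSeries ι) (s : NCSeries ι) :
    deriv2 f s = ∑ i, ∑ j, s.coeff [i, j] •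
      (f (Pi.single i 1) * ofH (Pi.single j 1) + ofH (Pi.single i 1) * f (Pi.single j 1)) := rfl

theorem deriv2_homog (f : (ι → ℚ) →ₗ[ℚ] NCSeries ι) (s : NCSeries ι) :
    deriv2 f (homog 2 s) = deriv2 f s := by
  simp [deriv2_apply]

theorem deriv2_zero : deriv2 (0 : (ι → ℚ) →ₗ[ℚ] NCSeries ι) = 0 := by
  refine LinearMap.ext fun s => ?_
  simp [deriv2_apply]

theorem map_eq_sum_single (f : (ι → ℚ) →ₗ[ℚ] NCSeries ι) (v : ι → ℚ) :
    f v = ∑ i, v i • f (Pi.single i 1) := by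
  conv_lhs => rw [pi_eq_sum_univ' v, map_sum]
  simp only [map_smul]

/-- An automorphism in `IA` acts on the leading two components of a series of degree at least two
through its first component. -/
theorem homog_three_map (hU : IsIA U) {d : NCSeries ι} (hd : InFil 2 d) :
    homog 3 (U d) = homog 3 d + deriv2 (component 1 U) d := by
  have e : U d - d = ∑ i, ((U (ofH (Pi.single i 1)) - ofH (Pi.single i 1)) * U (tail i d) +
      ofH (Pi.single i 1) * (U (tail i d) - tail i d)) := by
    conv_lhs => rw [eq_sum_tail_of_inFil_one (hd.mono one_le_two)]
    rw [map_sum, ← Finset.sum_sub_distrib]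
    refine Finset.sum_congr rfl fun i _ => ?_
    rw [map_mul]
    noncomm_ring
  rw [← sub_eq_iff_eq_add', ← map_sub, e, map_sum, deriv2_apply]
  refine Finset.sum_congr rfl fun i _ => ?_
  have ht : InFil 1 (tail i d) := hd.tail i
  -- The linear part of the tail, which is all that the components of degree three see of it here.
  let v : ι → ℚ := fun j => d.coeff [i, j]
  have htv : InFil 2 (tail i d - ofH v) := by
    rw [inFil_two_iff]
    exact ⟨by simpa using hd [i] (by simp), fun j => by simp [v]⟩
  have h1 : homog 1 (U (tail i d)) = ofH v := by
    rw [(hU.2 _ ht).homog_eq one_lt_two, htv.homog_eq one_lt_two, homog_one_ofH]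
  have h2 : homog 2 (U (tail i d) - tail i d) = component 1 U v := by
    rw [component_eq_homog_sub one_ne_zero]
    refine InFil.homog_eq (p := 3) ?_ (by omega)
    have := hU.inFil_sub htv
    rw [map_sub] at this
    convert this using 1
    abel
  rw [map_add, (hU.2 _ (inFil_ofH _)).homog_mul ((hU.1 1 _).2 ht), h1,
    (inFil_ofH (Pi.single i 1)).homog_mul (hU.2 _ ht), h2, homog_one_ofH,
    ← component_eq_homog_sub one_ne_zero]
  simp only [smul_add, Finset.sum_add_distrib]
  rw [ofH_eq_sum v, map_eq_sum_single (component 1 U) v, Finset.mul_sum, Finset.mul_sum]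
  simp [v]

/-- With `V v = v + d` and `d` of degree at least two, `U (V v) = U v + U d`. The action of `U` on
the quadratic part of `d` produces the cross term. -/
theorem component_two_trans (hU : IsIA U) (hV : IsIA V) :
    component 2 (V.trans U) =
      component 2 U + component 2 V + deriv2 (component 1 U) ∘ₗ component 1 V := by
  refine LinearMap.ext fun v => ?_
  have h := homog_three_map hU (hV.2 _ (inFil_ofH v))
  rw [map_sub U, map_sub, map_sub, sub_eq_iff_eq_add] at h
  rw [LinearMap.add_apply, LinearMap.add_apply, LinearMap.comp_apply, component_apply,
    component_apply, component_apply, AlgEquiv.trans_apply, component_eq_homog_sub one_ne_zero,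
    deriv2_homog, h, homog_ofH (by omega)]
  abel

theorem component_one_conj (hU : IsIA U) (hV : IsIA V) :
    component 1 ((U.symm.trans V).trans U) = component 1 V := by
  have h := component_one_trans hU hU.symm
  rw [AlgEquiv.symm_trans_self, component_refl one_ne_zero] at h
  rw [component_one_trans hU (hU.symm.trans hV), component_one_trans hV hU.symm,
    add_left_comm, ← h, add_zero]

/-- When `V₁ = 0`, the cross terms that involve `V` disappear, and those left belong to the
expansion of `U ∘ U⁻¹ = 1`. -/
theorem component_two_conj (hU : IsIA U) (hV : IsIA V) (h1 : component 1 V = 0) :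
    component 2 ((U.symm.trans V).trans U) = component 2 V := by
  have h := component_two_trans hU hU.symm
  rw [AlgEquiv.symm_trans_self, component_refl two_ne_zero] at h
  rw [component_two_trans hU (hU.symm.trans hV), component_two_trans hV hU.symm,
    component_one_trans hV hU.symm, h1, deriv2_zero, zero_add, LinearMap.zero_comp, add_zero,
    add_left_comm, add_assoc, ← h, add_zero]

end Component

end NCSeries
namespace FatgraphJohnson

variable {g : ℕ}

/-! # Magnus expansions -/

theorem cls_one : cls (1 : Pi1 g) = 0 := by simp [cls]

theorem cls_mul (a b : Pi1 g) : cls (a * b) = cls a + cls b := by simp [cls]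

theorem cls_inv (a : Pi1 g) : cls a⁻¹ = -cls a := by simp [cls]

theorem hom_ext {M : Type*} [Monoid M] {f f' : Pi1 g →* M}
    (h : ∀ i, f (FreeGroup.of i) = f' (FreeGroup.of i)) : f = f' := by
  refine MonoidHom.eq_of_eqOn_dense (FreeGroup.closure_range_of (Idx g)) ?_
  rintro _ ⟨i, rfl⟩
  exact h i

/-- For a multiplicative map on a free group, the constant and linear terms are determined by those
on the generators. -/
theorem inFil_two_of_generators {α : Type} {F : FreeGroup α →* That g}
    {κ : FreeGroup α →* Multiplicative (H g)}
    (h : ∀ x, InFil 2 (F (FreeGroup.of x) - (1 + ofH (κ (FreeGroup.of x)).toAdd)))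
    (y : FreeGroup α) : InFil 2 (F y - (1 + ofH (κ y).toAdd)) := by
  induction y using FreeGroup.induction_on with
  | C1 => simpa using InFil.zero 2
  | of x => exact h x
  | inv_of x hx =>
    set V : That g := ofH (κ (FreeGroup.of x)).toAdd with hV
    -- To first order the inverse of `1 + V` is `1 - V`, with error `V * V`; the identity makes both
    -- error terms explicit.
    have e : F (FreeGroup.of x)⁻¹ - (1 - V) =
        F (FreeGroup.of x)⁻¹ * (V * V - (F (FreeGroup.of x) - (1 + V)) * (1 - V)) := by
      have e1 : F (FreeGroup.of x)⁻¹ * F (FreeGroup.of x) = 1 := by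
        rw [← map_mul, inv_mul_cancel, map_one]
      have e2 : V * V - (F (FreeGroup.of x) - (1 + V)) * (1 - V) =
          1 - F (FreeGroup.of x) * (1 - V) := by noncomm_ring
      rw [e2, mul_sub _ 1, ← mul_assoc, e1, mul_one, one_mul]
    rw [map_inv κ, toAdd_inv, map_neg, ← hV, ← sub_eq_add_neg, e]
    exact (((inFil_ofH _).mul (inFil_ofH _)).sub (hx.mul_right _)).mul_left _
  | mul a b ha hb =>
    rw [map_mul, map_mul, toAdd_mul, map_add]
    refine (ha.mul_sub_mul hb).trans ?_
    have e : ∀ V W : That g, (1 + V) * (1 + W) - (1 + (V + W)) = V * W := fun V W => by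
      noncomm_ring
    rw [e]
    exact (inFil_ofH _).mul (inFil_ofH _)

theorem isMagnus_iff {θ : Pi1 g →* That g} :
    IsMagnus θ ↔ ∀ a, InFil 2 (θ a - (1 + ofH (cls a))) := by
  refine forall_congr' fun a => ?_
  rw [inFil_two_iff]
  simp [sub_eq_zero]

theorem isMagnus_of_generators {θ : Pi1 g →* That g}
    (h : ∀ i, InFil 2 (θ (FreeGroup.of i) - (1 + ofH (Pi.single i 1)))) : IsMagnus θ :=
  isMagnus_iff.2 <| inFil_two_of_generators (κ := clsHom g) fun i => by
    have := h i
    rwa [← cls_of] at this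

theorem stdMagnus_of (i : Idx g) : stdMagnus g (FreeGroup.of i) = 1 + ofH (Pi.single i 1) := by
  simp [stdMagnus, stdUnit]

theorem isMagnus_stdMagnus : IsMagnus (stdMagnus g) :=
  isMagnus_of_generators fun i => by rw [stdMagnus_of, sub_self]; exact InFil.zero 2

namespace IsMagnus

variable {θ θ' : Pi1 g →* That g}

theorem inFil_sub_one (hθ : IsMagnus θ) (a : Pi1 g) : InFil 1 (θ a - 1) :=
  inFil_one_iff.2 (by simp [(hθ a).1])

theorem inFil_sub (hθ : IsMagnus θ) (a : Pi1 g) : InFil 2 (θ a - (1 + ofH (cls a))) :=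
  isMagnus_iff.1 hθ a

/-- Every expansion is the standard one followed by an automorphism in `IA`. -/
theorem exists_takes_stdMagnus (hθ : IsMagnus θ) : ∃ U, Takes (stdMagnus g) θ U := by
  have ha : ∀ i, InFil 1 (θ (FreeGroup.of i) - 1) := fun i => hθ.inFil_sub_one _
  have hA : ∀ p f, InFil p f → InFil (p + 1) (substAlgHom ha f - f) := fun p f hf => by
    refine inFil_map_sub (fun i => ?_) p hf
    rw [substAlgHom_ofH, sub_sub, ← cls_of]
    exact hθ.inFil_sub _
  refine ⟨AlgEquiv.ofBijective (substAlgHom ha)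
    (bijective_of_unipotent (A := (substAlgHom ha).toLinearMap) hA),
    IsIA.of_unipotent hA, fun x => ?_⟩
  have : ((substAlgHom ha : That g →ₐ[ℚ] That g) : That g →* That g).comp (stdMagnus g) = θ :=
    hom_ext fun i => by
      simp [stdMagnus_of, substAlgHom_ofH]
  exact DFunLike.congr_fun this x

/-- No continuity is assumed. On a variable, `U - V` equals `V - U` on the remainder `r` of `θ`;
since `r` has degree at least two, agreement of `U` and `V` modulo degree `n` improves to degree `n
+ 1`. -/
theorem takes_unique (hθ : IsMagnus θ) {U V : That g ≃ₐ[ℚ] That g} (hU : IsIA U) (hV : IsIA V)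
    (h : ∀ x, U (θ x) = V (θ x)) : U = V := by
  have key : ∀ n f, InFil n (U f - V f) := by
    intro n
    induction n with
    | zero => exact fun f => InFil.zero_fil _
    | succ n ih =>
      have hprod : ∀ f k : That g, U (f * k) - V (f * k) =
          (U f - V f) * U k + V f * (U k - V k) := fun f k => by
        rw [map_mul, map_mul]; noncomm_ring
      have hV1 : ∀ i : Idx g, InFil 1 (V (ofH (Pi.single i 1))) := fun i =>
        (hV.1 1 _).2 (inFil_ofH _)
      have hX : ∀ i : Idx g, InFil (n + 1) (U (ofH (Pi.single i 1)) - V (ofH (Pi.single i 1))) := by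
        intro i
        let r : That g := θ (FreeGroup.of i) - (1 + ofH (Pi.single i 1))
        have hr : InFil 2 r := by
          have := hθ.inFil_sub (FreeGroup.of i)
          rwa [cls_of] at this
        have e : U (ofH (Pi.single i 1)) - V (ofH (Pi.single i 1)) = V r - U r := by
          simp only [r, map_sub, map_add, map_one, h]
          abel
        rw [e, eq_sum_tail_of_inFil_one (hr.mono one_le_two), map_sum, map_sum]
        refine InFil.sub_comm ?_
        rw [← Finset.sum_sub_distrib]
        refine InFil.sum fun j _ => ?_
        rw [hprod]
        exact ((ih _).mul ((hU.1 1 _).2 (hr.tail j))).add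
          (((hV1 j).mul (ih _)).mono (by omega))
      intro f
      have e : U f - V f = ∑ i, ((U (ofH (Pi.single i 1)) - V (ofH (Pi.single i 1))) *
          U (tail i f) + V (ofH (Pi.single i 1)) * (U (tail i f) - V (tail i f))) := by
        conv_lhs => rw [eq_sum_tail f]
        simp only [map_add, map_smul, map_one, map_sum, add_sub_add_left_eq_sub]
        rw [← Finset.sum_sub_distrib]
        exact Finset.sum_congr rfl fun i _ => hprod _ _
      rw [e]
      exact InFil.sum fun i _ => ((hX i).mul_right _).add (((hV1 i).mul (ih _)).mono (by omega))
  exact AlgEquiv.ext fun f => InFil.ext_of_sub fun n => key n f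

theorem existsUnique_takes (hθ : IsMagnus θ) (hθ' : IsMagnus θ') : ∃! U, Takes θ' θ U := by
  obtain ⟨A, hA, hAθ⟩ := hθ.exists_takes_stdMagnus
  obtain ⟨B, hB, hBθ⟩ := hθ'.exists_takes_stdMagnus
  refine ⟨B.symm.trans A, ⟨hB.symm.trans hA, fun x => ?_⟩, fun V hV => ?_⟩
  · rw [AlgEquiv.trans_apply, ← hBθ, AlgEquiv.symm_apply_apply, hAθ]
  · refine hθ'.takes_unique hV.1 (hB.symm.trans hA) fun x => ?_
    rw [hV.2, AlgEquiv.trans_apply, ← hBθ, AlgEquiv.symm_apply_apply, hAθ]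

theorem takes_transition (hθ : IsMagnus θ) (hθ' : IsMagnus θ') :
    Takes θ' θ (transition θ θ') :=
  Classical.epsilon_spec (hθ.existsUnique_takes hθ').exists

theorem isIA_transition (hθ : IsMagnus θ) (hθ' : IsMagnus θ') : IsIA (transition θ θ') :=
  (hθ.takes_transition hθ').1

theorem transition_eq (hθ : IsMagnus θ) (hθ' : IsMagnus θ') {U : That g ≃ₐ[ℚ] That g}
    (hU : Takes θ' θ U) : transition θ θ' = U :=
  (hθ.existsUnique_takes hθ').unique (hθ.takes_transition hθ') hU

theorem transition_self (hθ : IsMagnus θ) : transition θ θ = AlgEquiv.refl :=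
  hθ.transition_eq hθ ⟨IsIA.refl, fun _ => rfl⟩

theorem transition_trans {θ'' : Pi1 g →* That g} (hθ : IsMagnus θ) (hθ' : IsMagnus θ')
    (hθ'' : IsMagnus θ'') :
    transition θ θ'' = (transition θ' θ'').trans (transition θ θ') := by
  refine hθ.transition_eq hθ'' ⟨(hθ'.isIA_transition hθ'').trans (hθ.isIA_transition hθ'),
    fun x => ?_⟩
  rw [AlgEquiv.trans_apply, (hθ'.takes_transition hθ'').2, (hθ.takes_transition hθ').2]

/-- Elements of the lower central series differ from `1` in high degrees only. -/
theorem inFil_of_mem_lowerCentralSeries (hθ : IsMagnus θ) (m : ℕ) {x : Pi1 g}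
    (hx : x ∈ (⊤ : Subgroup (Pi1 g)).lowerCentralSeries m) : InFil (m + 1) (θ x - 1) := by
  let D : ℕ → Subgroup (Pi1 g) := fun p =>
    { carrier := {x | InFil p (θ x - 1)}
      one_mem' := by simpa using InFil.zero p
      mul_mem' := fun {a b} ha hb => by
        have := InFil.mul_sub_mul (f := θ a) (f' := 1) (h := θ b) (h' := 1) ha hb
        rwa [mul_one, ← map_mul] at this
      inv_mem' := fun {a} ha => by
        have e : θ a⁻¹ - 1 = θ a⁻¹ * (1 - θ a) := by
          rw [mul_sub, mul_one, ← map_mul, inv_mul_cancel, map_one]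
        change InFil p (θ a⁻¹ - 1)
        rw [e]
        exact (InFil.sub_comm ha).mul_left _ }
  suffices h : (⊤ : Subgroup (Pi1 g)).lowerCentralSeries m ≤ D (m + 1) from h hx
  clear hx
  induction m with
  | zero => exact fun a _ => hθ.inFil_sub_one a
  | succ m ih =>
    rw [Subgroup.lowerCentralSeries_succ, Subgroup.commutator_le]
    intro a ha b _
    have ha' : InFil (m + 1) (θ a - 1) := ih ha
    have hb' := hθ.inFil_sub_one b
    -- A group commutator minus `1` is, up to a unit, the ring commutator of `θ a - 1` and `θ b -
    -- 1`, whose degrees add.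
    have e : θ (a * b * a⁻¹ * b⁻¹) - 1 = ((θ a - 1) * (θ b - 1) - (θ b - 1) * (θ a - 1)) *
        θ (a⁻¹ * b⁻¹) := by
      have e1 : (θ a - 1) * (θ b - 1) - (θ b - 1) * (θ a - 1) = θ (a * b) - θ (b * a) := by
        rw [map_mul, map_mul]; noncomm_ring
      rw [e1, sub_mul, ← map_mul, ← map_mul]
      rw [show b * a * (a⁻¹ * b⁻¹) = 1 by group, map_one, ← mul_assoc]
    change InFil (m + 1 + 1) (θ (a * b * a⁻¹ * b⁻¹) - 1)
    rw [e]
    exact ((ha'.mul hb').sub ((hb'.mul ha').mono (by omega))).mul_right _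

end IsMagnus

/-! # Sequences of expansions -/

section Sequence

theorem component_one_transition_last {k : ℕ} (θ : Fin (k + 1) → (Pi1 g →* That g))
    (hθ : ∀ i, IsMagnus (θ i)) : component 1 (transition (θ 0) (θ (Fin.last k))) =
      ∑ i : Fin k, component 1 (transition (θ i.castSucc) (θ i.succ)) := by
  induction k with
  | zero =>
    rw [Fin.last_zero, (hθ 0).transition_self, component_refl one_ne_zero]
    simp
  | succ k ih =>
    rw [(hθ 0).transition_trans (hθ 1) (hθ _),
      component_one_trans ((hθ 0).isIA_transition (hθ 1)) ((hθ 1).isIA_transition (hθ _)),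
      Fin.sum_univ_succ]
    exact congrArg _ (ih (fun i => θ i.succ) fun i => hθ _)

/-- Splitting off the first transition map creates one cross term, between it and the sum of the
first components of all the later ones. -/
theorem component_two_transition_last {k : ℕ} (θ : Fin (k + 1) → (Pi1 g →* That g))
    (hθ : ∀ i, IsMagnus (θ i)) : component 2 (transition (θ 0) (θ (Fin.last k))) =
      ∑ i : Fin k, (component 2 (transition (θ i.castSucc) (θ i.succ)) +
        deriv2 (component 1 (transition (θ i.castSucc) (θ i.succ))) ∘ₗ
          ∑ j ∈ Finset.Ioi i, component 1 (transition (θ j.castSucc) (θ j.succ))) := by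
  induction k with
  | zero =>
    rw [Fin.last_zero, (hθ 0).transition_self, component_refl two_ne_zero]
    simp
  | succ k ih =>
    rw [(hθ 0).transition_trans (hθ 1) (hθ _),
      component_two_trans ((hθ 0).isIA_transition (hθ 1)) ((hθ 1).isIA_transition (hθ _)),
      Fin.sum_univ_succ]
    have h1 := component_one_transition_last (fun i => θ i.succ) fun i => hθ _
    have h2 := ih (fun i => θ i.succ) fun i => hθ _
    simp only [Fin.succ_last, Fin.succ_zero_eq_one] at h1 h2
    rw [h1, h2, Fin.sum_Ioi_zero, add_right_comm]
    simp only [Fin.sum_Ioi_succ]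
    rfl

end Sequence

end FatgraphJohnson
namespace FatgraphJohnson

variable {g : ℕ}

/-! # The action on the completed tensor algebra induced from homology -/

section HomAct

variable (φ : MulAut (Pi1 g))

theorem homAct_coeff_nil (s : That g) : (homAct φ s).coeff [] = s.coeff [] := by
  simp [homAct]

/-- A recursion on the first letter, in the same shape as `coeff_mul_cons`; it carries the proof
that the action is multiplicative. -/
theorem homAct_coeff_cons (s : That g) (a : Idx g) (w : List (Idx g)) :
    (homAct φ s).coeff (a :: w) =
      ∑ i, cls (φ (FreeGroup.of i)) a * (homAct φ (s.tail i)).coeff w := by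
  simp only [homAct, List.length_cons]
  rw [← (Fin.consEquiv fun _ : Fin (w.length + 1) => Idx g).sum_comp, Fintype.sum_prod_type]
  refine Finset.sum_congr rfl fun i _ => ?_
  rw [Finset.mul_sum]
  refine Finset.sum_congr rfl fun v _ => ?_
  rw [Fin.prod_univ_succ]
  simp [List.ofFn_succ]
  ring

theorem homAct_add (s t : That g) : homAct φ (s + t) = homAct φ s + homAct φ t := by
  ext w
  simp [homAct, add_mul, Finset.sum_add_distrib]

theorem homAct_smul (c : ℚ) (s : That g) : homAct φ (c • s) = c • homAct φ s := by
  ext w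
  simp [homAct, mul_assoc, Finset.mul_sum]

/-- The induced action as a linear map. -/
noncomputable def homActLinear : That g →ₗ[ℚ] That g where
  toFun := homAct φ
  map_add' := homAct_add φ
  map_smul' := homAct_smul φ

theorem homAct_one : homAct φ 1 = 1 := by
  ext w
  cases w with
  | nil => exact homAct_coeff_nil φ 1
  | cons a w =>
    have h0 : homAct φ (0 : That g) = 0 := (homActLinear φ).map_zero
    simp [homAct_coeff_cons, tail_one, h0]

theorem homAct_mul (s t : That g) : homAct φ (s * t) = homAct φ s * homAct φ t := by
  ext w
  induction w generalizing s t with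
  | nil => simp [homAct_coeff_nil]
  | cons a w ih =>
    have e : (homAct φ s).tail a = ∑ i, cls (φ (FreeGroup.of i)) a • homAct φ (s.tail i) := by
      ext v
      simp [homAct_coeff_cons]
    rw [coeff_mul_cons, e, homAct_coeff_cons, homAct_coeff_cons, Finset.sum_mul, coeff_sum,
      Finset.mul_sum, ← Finset.sum_add_distrib]
    refine Finset.sum_congr rfl fun i _ => ?_
    rw [tail_mul, homAct_add, homAct_smul, coeff_add, coeff_smul, ih, homAct_coeff_nil,
      smul_mul_assoc, coeff_smul]
    ring

/-- The induced action as a homomorphism of algebras. -/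
noncomputable def homActAlgHom : That g →ₐ[ℚ] That g :=
  AlgHom.ofLinearMap (homActLinear φ) (homAct_one φ) (homAct_mul φ)

theorem homAct_neg (s : That g) : homAct φ (-s) = -homAct φ s := (homActAlgHom φ).map_neg s

theorem homAct_sub (s t : That g) : homAct φ (s - t) = homAct φ s - homAct φ t :=
  (homActAlgHom φ).map_sub s t

theorem homAct_pow (s : That g) (n : ℕ) : homAct φ (s ^ n) = homAct φ s ^ n :=
  (homActAlgHom φ).map_pow s n

theorem homAct_homog (n : ℕ) (s : That g) : homAct φ (homog n s) = homog n (homAct φ s) := by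
  ext w
  by_cases h : w.length = n <;> simp [homAct, h]

/-- The action preserves word length, so the truncation bound in `exp` is the same on both sides and
the two finite sums can be interchanged. -/
theorem homAct_exp (s : That g) : homAct φ (NCSeries.exp s) = NCSeries.exp (homAct φ s) := by
  ext w
  simp only [NCSeries.exp, ← homAct_pow]
  simp only [homAct, List.length_ofFn, Finset.sum_mul, Finset.mul_sum, mul_assoc]
  rw [Finset.sum_comm]

theorem homAct_log (s : That g) : homAct φ (NCSeries.log s) = NCSeries.log (homAct φ s) := by
  ext w
  have e : homAct φ s - 1 = homAct φ (s - 1) := by rw [homAct_sub, homAct_one]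
  simp only [NCSeries.log, e, ← homAct_pow]
  simp only [homAct, List.length_ofFn, Finset.sum_mul, Finset.mul_sum, mul_assoc]
  rw [Finset.sum_comm]

theorem homAct_hausdorff (s t : That g) :
    homAct φ (hausdorff s t) = hausdorff (homAct φ s) (homAct φ t) := by
  simp only [hausdorff, homAct_sub, homAct_log, homAct_mul, homAct_exp]

theorem cls_apply (x : Pi1 g) (j : Idx g) :
    cls (φ x) j = ∑ i, cls x i * cls (φ (FreeGroup.of i)) j := by
  induction x using FreeGroup.induction_on with
  | C1 => simp [cls_one]
  | of i => simp [cls_of, Pi.single_apply]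
  | inv_of i h => simp only [map_inv, cls_inv, Pi.neg_apply, h, neg_mul, Finset.sum_neg_distrib]
  | mul a b ha hb =>
    simp only [map_mul, cls_mul, Pi.add_apply, ha, hb, add_mul, Finset.sum_add_distrib]

theorem homAct_coeff_singleton (s : That g) (j : Idx g) :
    (homAct φ s).coeff [j] = ∑ i, s.coeff [i] * cls (φ (FreeGroup.of i)) j := by
  rw [homAct_coeff_cons]
  simp [homAct_coeff_nil, mul_comm]

theorem homAct_ofH_cls (x : Pi1 g) : homAct φ (ofH (cls x)) = ofH (cls (φ x)) := by
  ext w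
  rcases w with _ | ⟨j, _ | ⟨k, w⟩⟩
  · simp [homAct_coeff_nil]
  · rw [homAct_coeff_singleton, coeff_ofH_singleton, cls_apply]
    simp
  · rw [homAct_coeff_cons, coeff_ofH_cons_cons]
    refine Finset.sum_eq_zero fun i _ => ?_
    rw [tail_ofH', homAct_smul, homAct_one]
    simp

end HomAct

/-- The expansion `|φ| ∘ θ ∘ φ⁻¹`. -/
noncomputable def conjExpansion (φ : MulAut (Pi1 g)) (θ : Pi1 g →* That g) : Pi1 g →* That g :=
  ((homActAlgHom φ : That g →* That g).comp θ).comp (φ⁻¹ : MulAut (Pi1 g)).toMonoidHom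

theorem conjExpansion_apply (φ : MulAut (Pi1 g)) (θ : Pi1 g →* That g) (x : Pi1 g) :
    conjExpansion φ θ (φ x) = homAct φ (θ x) := by
  change homAct φ (θ ((φ⁻¹ : MulAut (Pi1 g)) (φ x))) = _
  rw [MulAut.inv_apply_self]

theorem IsMagnus.conjExpansion {θ : Pi1 g →* That g} (hθ : IsMagnus θ) (φ : MulAut (Pi1 g)) :
    IsMagnus (conjExpansion φ θ) := by
  intro a
  obtain ⟨x, rfl⟩ := φ.surjective a
  rw [conjExpansion_apply, homAct_coeff_nil]
  refine ⟨(hθ x).1, fun j => ?_⟩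
  rw [homAct_coeff_singleton, cls_apply]
  simp only [(hθ x).2]

/-! # Total Johnson maps -/

/-- Reindexing along the bijection `φ` turns the two functions that define the total Johnson map
into two expansions, to which the results on transition maps apply. -/
theorem takes_conjExpansion_iff {φ : MCG g} {θ : Pi1 g →* That g} {U : That g ≃ₐ[ℚ] That g} :
    Takes (fun x => homAct φ.1 (θ x)) (fun x => θ (φ.1 x)) U ↔
      Takes (conjExpansion φ.1 θ) θ U := by
  refine and_congr_right fun _ => ⟨fun h x => ?_, fun h x => ?_⟩
  · obtain ⟨y, rfl⟩ := φ.1.surjective x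
    rw [conjExpansion_apply]
    exact h y
  · change U (homAct φ.1 (θ x)) = θ (φ.1 x)
    rw [← conjExpansion_apply]
    exact h _

theorem totalJohnson_eq (θ : Pi1 g →* That g) (φ : MCG g) :
    totalJohnson θ φ = transition θ (conjExpansion φ.1 θ) := by
  unfold totalJohnson transition
  congr 1
  funext U
  exact propext takes_conjExpansion_iff

theorem existsUnique_takes_homAct {θ : Pi1 g →* That g} (hθ : IsMagnus θ) (φ : MCG g) :
    ∃! U, Takes (fun x => homAct φ.1 (θ x)) (fun x => θ (φ.1 x)) U := by
  simp only [takes_conjExpansion_iff]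
  exact hθ.existsUnique_takes (hθ.conjExpansion φ.1)

/-! ### Total Johnson maps on the Torelli groups and independence of the expansion -/

section Torelli

variable {φ : MCG g}

theorem torelli_antitone : Antitone (torelli g) := fun _ _ h _ hφ x =>
  Subgroup.lowerCentralSeries_antitone _ h (hφ x)

theorem existsUnique_takes_torelli {θ : Pi1 g →* That g} (hθ : IsMagnus θ)
    (hφ : φ ∈ torelli g 1) : ∃! U, Takes θ (fun x => θ (φ.1 x)) U := by
  have := existsUnique_takes_homAct hθ φ
  simpa only [homAct_of_torelli hφ] using this

theorem takes_totalJohnson {θ : Pi1 g →* That g} (hθ : IsMagnus θ) (hφ : φ ∈ torelli g 1) :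
    Takes θ (fun x => θ (φ.1 x)) (totalJohnson θ φ) := by
  have := takes_conjExpansion_iff.2 (hθ.takes_transition (hθ.conjExpansion φ.1))
  rw [← totalJohnson_eq] at this
  simpa only [homAct_of_torelli hφ] using this

/-- On the Torelli group, total Johnson maps for two expansions are conjugate in `IA`. -/
theorem totalJohnson_conj {θ θ' : Pi1 g →* That g} (hθ : IsMagnus θ) (hθ' : IsMagnus θ')
    (hφ : φ ∈ torelli g 1) :
    totalJohnson θ φ =
      ((transition θ θ').symm.trans (totalJohnson θ' φ)).trans (transition θ θ') := by
  have hU := hθ.takes_transition hθ'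
  have h' := takes_totalJohnson hθ' hφ
  refine (existsUnique_takes_torelli hθ hφ).unique (takes_totalJohnson hθ hφ)
    ⟨(hU.1.symm.trans h'.1).trans hU.1, fun x => ?_⟩
  rw [AlgEquiv.trans_apply, AlgEquiv.trans_apply, ← hU.2, AlgEquiv.symm_apply_apply, h'.2, hU.2]

theorem component_one_totalJohnson {θ θ' : Pi1 g →* That g} (hθ : IsMagnus θ)
    (hθ' : IsMagnus θ') (hφ : φ ∈ torelli g 1) :
    component 1 (totalJohnson θ φ) = component 1 (totalJohnson θ' φ) := by
  rw [totalJohnson_conj hθ hθ' hφ, component_one_conj (hθ.isIA_transition hθ')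
    (takes_totalJohnson hθ' hφ).1]

/-- Johnson's homomorphism is the leading component of the total Johnson map of the standard
expansion. -/
theorem johnsonHom_eq_component {m : ℕ} (hm : 1 ≤ m) (hφ : φ ∈ torelli g m) :
    johnsonHom m φ = component m (totalJohnson (stdMagnus g) φ) := by
  have hT := takes_totalJohnson isMagnus_stdMagnus (torelli_antitone hm hφ)
  refine LinearMap.pi_ext' fun i => LinearMap.ext_ring ?_
  rw [LinearMap.comp_apply, LinearMap.comp_apply, LinearMap.single_apply,
    component_eq_homog_sub (by omega), johnsonHom, Fintype.linearCombination_apply_single, one_smul]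
  have h1 := isMagnus_stdMagnus.inFil_of_mem_lowerCentralSeries m (hφ (FreeGroup.of i))
  -- For the standard expansion `θ(x) = 1 + [x]` on a generator, so the displacement of `[x]` is
  -- `θ(φ(x)) - θ(x) = (θ(φ(x) x⁻¹) - 1) θ(x)`; the factor `θ(x)` does not change its leading term.
  have h2 : totalJohnson (stdMagnus g) φ (ofH (Pi.single i 1)) - ofH (Pi.single i 1) =
      (stdMagnus g (φ.1 (FreeGroup.of i) * (FreeGroup.of i)⁻¹) - 1) *
        (1 + ofH (Pi.single i 1)) := by
    have h3 : totalJohnson (stdMagnus g) φ (stdMagnus g (FreeGroup.of i)) =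
      stdMagnus g (φ.1 (FreeGroup.of i)) := hT.2 (FreeGroup.of i)
    rw [sub_mul, ← stdMagnus_of, ← map_mul, inv_mul_cancel_right, one_mul, ← h3, stdMagnus_of,
      map_add, map_one, add_sub_add_left_eq_sub]
  rw [h2, mul_add, mul_one, map_add, (h1.mul (inFil_ofH _)).homog_eq_zero (by omega), add_zero,
    map_sub, homog_one (by omega), sub_zero]

/-- The component does not depend on the expansion, and for the standard one `φ(x) x⁻¹ ∈ Γ_2`
differs from `1` only in degrees at least three. -/
theorem component_one_totalJohnson_eq_zero {θ : Pi1 g →* That g} (hθ : IsMagnus θ)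
    (hφ : φ ∈ torelli g 2) : component 1 (totalJohnson θ φ) = 0 := by
  have hφ1 := torelli_antitone one_le_two hφ
  rw [component_one_totalJohnson hθ isMagnus_stdMagnus hφ1,
    ← johnsonHom_eq_component le_rfl hφ1]
  refine LinearMap.pi_ext' fun i => LinearMap.ext_ring ?_
  rw [LinearMap.comp_apply, LinearMap.single_apply, johnsonHom,
    Fintype.linearCombination_apply_single, one_smul, LinearMap.comp_apply, LinearMap.zero_apply]
  have h1 := isMagnus_stdMagnus.inFil_of_mem_lowerCentralSeries 2 (hφ (FreeGroup.of i))
  have h2 := h1.homog_eq_zero (q := 2) (by omega)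
  rwa [map_sub, homog_one (by omega), sub_zero] at h2

theorem component_two_totalJohnson {θ θ' : Pi1 g →* That g} (hθ : IsMagnus θ)
    (hθ' : IsMagnus θ') (hφ : φ ∈ torelli g 2) :
    component 2 (totalJohnson θ φ) = component 2 (totalJohnson θ' φ) := by
  have hφ1 := torelli_antitone one_le_two hφ
  rw [totalJohnson_conj hθ hθ' hφ1, component_two_conj (hθ.isIA_transition hθ')
    (takes_totalJohnson hθ' hφ1).1 (component_one_totalJohnson_eq_zero hθ' hφ)]

end Torelli

end FatgraphJohnson
namespace FatgraphJohnson

variable {g : ℕ}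

attribute [instance] TrivalentFatgraph.fintypeDart

namespace MarkedFatgraph

variable (G : MarkedFatgraph g)

/-! # Additive functions on the oriented edges -/

theorem next_bar_tail : G.next (G.bar G.tail) = G.bar G.tail := (G.next_eq_self_iff _).2 rfl

theorem next_ne {x : G.Dart} (hx : x ≠ G.bar G.tail) : G.next x ≠ x :=
  fun h => hx ((G.next_eq_self_iff x).1 h)

theorem next_ne_bar_tail {x : G.Dart} (hx : x ≠ G.bar G.tail) : G.next x ≠ G.bar G.tail :=
  fun h => hx (G.next.injective (h.trans G.next_bar_tail.symm))

theorem next_next_ne {x : G.Dart} (hx : x ≠ G.bar G.tail) : G.next (G.next x) ≠ x := fun h =>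
  G.next_ne hx <| by
    conv_lhs => rw [← h]
    exact G.next_next_next x

/-- Functions on the oriented edges which are odd and have sum zero at every trivalent vertex. -/
def additiveFunctions : Submodule ℚ (G.Dart → ℚ) where
  carrier := {c | (∀ x, c (G.bar x) = -c x) ∧
    ∀ x, x ≠ G.bar G.tail → c x + c (G.next x) + c (G.next (G.next x)) = 0}
  zero_mem' := by simp
  add_mem' := fun {c d} hc hd => ⟨fun x => by simp [hc.1, hd.1]; ring, fun x hx => by
    have h1 := hc.2 x hx
    have h2 := hd.2 x hx
    simp only [Pi.add_apply]
    linarith⟩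
  smul_mem' := fun r c hc => ⟨fun x => by simp [hc.1], fun x hx => by
    simp only [Pi.smul_apply, smul_eq_mul, ← mul_add, hc.2 x hx, mul_zero]⟩

/-- Functions on the (unoriented) edges. -/
def edgeFunctions : Submodule ℚ (G.Dart → ℚ) where
  carrier := {c | ∀ x, c (G.bar x) = c x}
  zero_mem' := by simp
  add_mem' := fun {c d} hc hd x => by simp [hc x, hd x]
  smul_mem' := fun r c hc x => by simp [hc x]

/-- Functions on the trivalent vertices. -/
def vertexFunctions : Submodule ℚ (G.Dart → ℚ) where
  carrier := {c | (∀ x, c (G.next x) = c x) ∧ c (G.bar G.tail) = 0}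
  zero_mem' := by simp
  add_mem' := fun {c d} hc hd => ⟨fun x => by simp [hc.1, hd.1], by simp [hc.2, hd.2]⟩
  smul_mem' := fun r c hc => ⟨fun x => by simp [hc.1], by simp [hc.2]⟩

theorem trace_eq_sum {n : Type*} [Fintype n] [DecidableEq n] (f : (n → ℚ) →ₗ[ℚ] (n → ℚ)) :
    LinearMap.trace ℚ _ f = ∑ x, f (Pi.single x 1) x := by
  rw [LinearMap.trace_eq_matrix_trace ℚ (Pi.basisFun ℚ n), Matrix.trace]
  simp

/-- The rank is the trace of the averaging projection. Reversal has no fixed points, so each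
oriented edge contributes `1 / 2`. -/
theorem finrank_edgeFunctions :
    2 * Module.finrank ℚ G.edgeFunctions = Fintype.card G.Dart := by
  classical
  let P : (G.Dart → ℚ) →ₗ[ℚ] (G.Dart → ℚ) :=
    (1 / 2 : ℚ) • (LinearMap.id + LinearMap.funLeft ℚ ℚ G.bar)
  have hP : ∀ c x, P c x = 1 / 2 * (c x + c (G.bar x)) := fun c x => rfl
  have hproj : LinearMap.IsProj G.edgeFunctions P := by
    refine ⟨fun c x => ?_, fun c hc => ?_⟩
    · rw [hP, hP, G.bar_bar, add_comm]
    · ext x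
      rw [hP, hc x]; ring
  have h := hproj.trace
  rw [trace_eq_sum] at h
  have h1 : ∀ x, P (Pi.single x 1) x = 1 / 2 := fun x => by
    rw [hP, Pi.single_eq_same, Pi.single_eq_of_ne (G.bar_ne x)]; ring
  simp only [h1, Finset.sum_const, Finset.card_univ, nsmul_eq_mul] at h
  have h2 : ((2 * Module.finrank ℚ G.edgeFunctions : ℕ) : ℚ) = Fintype.card G.Dart := by
    push_cast
    linarith
  exact_mod_cast h2

/-- Again a trace: averaging over the cyclic order contributes `1 / 3` for each oriented edge except
the one at the univalent vertex, which contributes nothing. -/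
theorem finrank_vertexFunctions :
    3 * Module.finrank ℚ G.vertexFunctions + 1 = Fintype.card G.Dart := by
  classical
  let Q : (G.Dart → ℚ) →ₗ[ℚ] (G.Dart → ℚ) :=
    { toFun := fun c x => if x = G.bar G.tail then 0 else
        1 / 3 * (c x + c (G.next x) + c (G.next (G.next x)))
      map_add' := fun c d => by
        ext x
        simp only [Pi.add_apply]
        split_ifs <;> ring
      map_smul' := fun r c => by
        ext x
        simp only [Pi.smul_apply, smul_eq_mul, RingHom.id_apply]
        split_ifs <;> ring }
  have hQ : ∀ c x, Q c x = if x = G.bar G.tail then 0 else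
    1 / 3 * (c x + c (G.next x) + c (G.next (G.next x))) := fun c x => rfl
  have hproj : LinearMap.IsProj G.vertexFunctions Q := by
    refine ⟨fun c => ⟨fun x => ?_, if_pos rfl⟩, fun c hc => ?_⟩
    · rw [hQ, hQ, G.next_next_next]
      by_cases hx : x = G.bar G.tail
      · rw [if_pos hx, if_pos (by rw [hx, G.next_bar_tail])]
      · rw [if_neg hx, if_neg (G.next_ne_bar_tail hx)]
        ring
    · ext x
      rw [hQ]
      split_ifs with hx
      · rw [hx, hc.2]
      · rw [hc.1 (G.next x), hc.1 x]; ring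
  have h := hproj.trace
  rw [trace_eq_sum] at h
  have h1 : ∀ x, Q (Pi.single x 1) x = 1 / 3 - if x = G.bar G.tail then 1 / 3 else 0 := fun x => by
    rw [hQ]
    split_ifs with hx
    · ring
    · rw [Pi.single_eq_same, Pi.single_eq_of_ne (G.next_ne hx),
        Pi.single_eq_of_ne (G.next_next_ne hx)]
      ring
  simp only [h1, Finset.sum_sub_distrib, Finset.sum_const, Finset.card_univ, nsmul_eq_mul,
    Finset.sum_ite_eq', Finset.mem_univ, if_true] at h
  have h2 : ((3 * Module.finrank ℚ G.vertexFunctions + 1 : ℕ) : ℚ) = Fintype.card G.Dart := by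
    push_cast
    linarith
  exact_mod_cast h2

/-- A function invariant under both `bar` and `next` is constant on the single boundary cycle, and
it vanishes at the reversed tail. -/
theorem disjoint_edgeFunctions_vertexFunctions :
    Disjoint G.edgeFunctions G.vertexFunctions := by
  rw [Submodule.disjoint_def]
  intro c he hv
  ext x
  obtain ⟨n, -, hn⟩ := (G.one_boundary x (G.bar G.tail)).exists_pow_eq'
  have hinv : ∀ n : ℕ, c (((G.bar * G.next) ^ n) x) = c x := by
    intro n
    induction n with
    | zero => rfl
    | succ n ih =>
      rw [pow_succ', Equiv.Perm.mul_apply, Equiv.Perm.mul_apply, he, hv.1, ih]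
  rw [← hinv n, hn, hv.2, Pi.zero_apply]

/-- For the standard inner product, odd functions are orthogonal to even ones, and functions with
zero vertex sums are orthogonal to those constant at each vertex. -/
theorem disjoint_additiveFunctions :
    Disjoint G.additiveFunctions (G.edgeFunctions ⊔ G.vertexFunctions) := by
  rw [Submodule.disjoint_def]
  intro c hc hc'
  obtain ⟨r, hr, s, hs, hrs⟩ := Submodule.mem_sup.1 hc'
  have h1 : ∑ x, c x * r x = 0 := by
    have := Equiv.sum_comp G.bar fun x => c x * r x
    simp only [hc.1, hr _, neg_mul, Finset.sum_neg_distrib] at this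
    linarith
  have h2 : ∑ x, c x * s x = 0 := by
    have e1 := Equiv.sum_comp G.next fun x => c x * s x
    have e2 := Equiv.sum_comp G.next fun x => c (G.next x) * s (G.next x)
    have e3 : ∑ x, (c x + c (G.next x) + c (G.next (G.next x))) * s x = 0 := by
      refine Finset.sum_eq_zero fun x _ => ?_
      by_cases hx : x = G.bar G.tail
      · rw [hx, hs.2, mul_zero]
      · rw [hc.2 x hx, zero_mul]
    simp only [add_mul, Finset.sum_add_distrib] at e3
    simp only [hs.1] at e1 e2
    linarith
  have h3 : ∑ x, c x * c x = 0 := by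
    have : ∀ x, c x * c x = c x * r x + c x * s x := fun x => by
      rw [← mul_add, ← Pi.add_apply, hrs]
    simp only [this, Finset.sum_add_distrib, h1, h2, add_zero]
  ext x
  exact mul_self_eq_zero.1
    ((Finset.sum_eq_zero_iff_of_nonneg fun x _ => mul_self_nonneg (c x)).1 h3 x
      (Finset.mem_univ x))

/-- Of the `12g - 2` dimensions, edge functions take `6g - 1` and vertex functions `4g - 1`. -/
theorem finrank_additiveFunctions_le : Module.finrank ℚ G.additiveFunctions ≤ 2 * g := by
  have h1 := Submodule.finrank_add_finrank_le_of_disjoint G.disjoint_additiveFunctions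
  have h2 := Submodule.finrank_sup_add_finrank_inf_eq G.edgeFunctions G.vertexFunctions
  rw [G.disjoint_edgeFunctions_vertexFunctions.eq_bot, finrank_bot] at h2
  rw [Module.finrank_fintype_fun_eq_card] at h1
  have h3 := G.finrank_edgeFunctions
  have h4 := G.finrank_vertexFunctions
  have h5 := G.genus
  omega

theorem cls_mark_bar (x : G.Dart) : cls (G.mark (G.bar x)) = -cls (G.mark x) := by
  rw [eq_neg_iff_add_eq_zero, ← cls_mul, G.mark_bar, cls_one]

theorem cls_mark_vertex {x : G.Dart} (hx : x ≠ G.bar G.tail) : cls (G.mark x) +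
    cls (G.mark (G.next x)) + cls (G.mark (G.next (G.next x))) = 0 := by
  rw [← cls_mul, ← cls_mul, G.mark_vertex x hx, cls_one]

/-- Additive functions on the oriented edges factor through homology. -/
theorem exists_eq_linear {c : G.Dart → ℚ} (hc : c ∈ G.additiveFunctions) :
    ∃ f : H g →ₗ[ℚ] ℚ, ∀ x, c x = f (cls (G.mark x)) := by
  -- The dual of `H` embeds in the additive functions because the marks generate. Its dimension `2g`
  -- is the upper bound, so it fills them.
  let F : (H g →ₗ[ℚ] ℚ) →ₗ[ℚ] (G.Dart → ℚ) :=
    { toFun := fun f x => f (cls (G.mark x))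
      map_add' := fun _ _ => rfl
      map_smul' := fun _ _ => rfl }
  have hF : Function.Injective F := by
    rw [injective_iff_map_eq_zero]
    intro f hf
    let K : Subgroup (Pi1 g) :=
      { carrier := {x | f (cls x) = 0}
        one_mem' := by simp [cls_one]
        mul_mem' := fun {a b} (ha : f (cls a) = 0) (hb : f (cls b) = 0) => by
          simp [cls_mul, ha, hb]
        inv_mem' := fun {a} (ha : f (cls a) = 0) => by simp [cls_inv, ha] }
    have hK : K = ⊤ := by
      rw [eq_top_iff, ← G.mark_full, Subgroup.closure_le]
      rintro _ ⟨x, rfl⟩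
      exact congrFun hf x
    refine LinearMap.pi_ext' fun i => LinearMap.ext_ring ?_
    have : FreeGroup.of i ∈ K := hK ▸ Subgroup.mem_top _
    rw [LinearMap.comp_apply, LinearMap.single_apply, ← cls_of]
    exact this
  have hle : LinearMap.range F ≤ G.additiveFunctions := by
    rintro _ ⟨f, rfl⟩
    refine ⟨fun x => ?_, fun x hx => ?_⟩
    · change f _ = -f _
      rw [G.cls_mark_bar, map_neg]
    · change f _ + f _ + f _ = 0
      rw [← map_add, ← map_add, G.cls_mark_vertex hx, map_zero]
  have hrank : Module.finrank ℚ (LinearMap.range F) = 2 * g := by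
    rw [LinearMap.finrank_range_of_inj hF]
    change Module.finrank ℚ (Module.Dual ℚ (H g)) = _
    rw [Subspace.dual_finrank_eq, Module.finrank_fintype_fun_eq_card]
    simp [two_mul]
  have heq := Submodule.eq_of_le_of_finrank_le hle (by
    rw [hrank]; exact G.finrank_additiveFunctions_le)
  rw [← heq] at hc
  obtain ⟨f, rfl⟩ := hc
  exact ⟨f, fun _ => rfl⟩

end MarkedFatgraph

end FatgraphJohnson

namespace NCSeries

variable {ι : Type} {p : ℕ}

/-! # Perturbation of products of exponentials -/

theorem inFil_mul_perturb {f f₀ D h h₀ D' : NCSeries ι} (hf : InFil (p + 2) (f - (f₀ + D)))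
    (hh : InFil (p + 2) (h - (h₀ + D'))) (hf₀ : InFil 1 (f₀ - 1)) (hh₀ : InFil 1 (h₀ - 1))
    (hD : InFil (p + 1) D) (hD' : InFil (p + 1) D') :
    InFil (p + 2) (f * h - (f₀ * h₀ + (D + D'))) := by
  refine (hf.mul_sub_mul hh).trans ?_
  have e : (f₀ + D) * (h₀ + D') - (f₀ * h₀ + (D + D')) =
      D * (h₀ - 1) + (f₀ - 1) * D' + D * D' := by noncomm_ring
  rw [e]
  exact ((hD.mul hh₀).add ((hf₀.mul hD').mono (by omega))).add ((hD.mul hD').mono (by omega))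

variable {X Y Z : NCSeries ι}

theorem inFil_exp_triple_perturb {D D' D'' : NCSeries ι} (hX : InFil 1 X) (hY : InFil 1 Y)
    (hZ : InFil 1 Z) (hD : InFil (p + 1) D) (hD' : InFil (p + 1) D') (hD'' : InFil (p + 1) D'') :
    InFil (p + 2) (exp (X + D) * exp (Y + D') * exp (Z + D'') -
      (exp X * exp Y * exp Z + (D + D' + D''))) := by
  have h1 := inFil_mul_perturb (inFil_exp_add hX hD) (inFil_exp_add hY hD')
    (inFil_exp_sub_one hX) (inFil_exp_sub_one hY) hD hD'
  refine inFil_mul_perturb h1 (inFil_exp_add hZ hD'') ?_ (inFil_exp_sub_one hZ) (hD.add hD') hD''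
  have := (inFil_exp_sub_one hX).mul_sub_mul (inFil_exp_sub_one hY)
  rwa [one_mul] at this

/-- If `exp X exp Y exp Z` is trivial below degree `p + 1`, then its component of this degree is
given by the Hausdorff series of `X` and `Y`. -/
theorem inFil_hausdorff (hZ : InFil 1 Z)
    (h : InFil (p + 1) (exp X * exp Y * exp Z - 1)) :
    InFil (p + 2) (hausdorff X Y - (exp X * exp Y * exp Z - 1 - (X + Y + Z))) := by
  set D := exp X * exp Y * exp Z - 1 with hD
  -- `exp X exp Y = (1 + D) exp (-Z)`, and in the leading degree the defect `D` may be moved into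
  -- the exponent; then the logarithm is taken.
  have h1 : InFil (p + 2) (exp X * exp Y - exp (-Z + D)) := by
    have e : exp X * exp Y - (exp (-Z) + D) = D * (exp (-Z) - 1) := by
      have e1 : exp X * exp Y = exp X * exp Y * exp Z * exp (-Z) := by
        rw [mul_assoc _ (exp Z), exp_mul_exp_neg hZ, mul_one]
      conv_lhs => rw [e1]
      rw [hD]
      noncomm_ring
    refine InFil.trans ?_ (inFil_exp_add hZ.neg h).sub_comm
    rw [e]
    exact h.mul (inFil_exp_sub_one hZ.neg)
  have h2 := h1.log_sub_log
  rw [log_exp (hZ.neg.add (h.mono (by omega)))] at h2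
  convert h2 using 1
  rw [hausdorff]
  abel

/-- Rotating the product conjugates it by `exp X`, which leaves the leading term of the defect
unchanged. -/
theorem inFil_exp_rotate (hX : InFil 1 X) (h : InFil (p + 1) (exp X * exp Y * exp Z - 1)) :
    InFil (p + 2) (exp Y * exp Z * exp X - exp X * exp Y * exp Z) := by
  have e : exp Y * exp Z * exp X - exp X * exp Y * exp Z =
      (exp (-X) - 1) * (exp X * exp Y * exp Z - 1) * exp X +
        (exp X * exp Y * exp Z - 1) * (exp X - 1) := by
    have e1 : exp Y * exp Z * exp X = exp (-X) * (exp X * exp Y * exp Z) * exp X := by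
      rw [mul_assoc (exp X), ← mul_assoc (exp (-X)), exp_neg_mul_exp hX, one_mul]
    have e2 : exp (-X) * exp X = 1 := exp_neg_mul_exp hX
    rw [e1]
    simp only [sub_mul, mul_sub, one_mul, mul_one, e2]
    abel
  rw [e]
  exact ((((inFil_exp_sub_one hX.neg).mul h).mono (by omega)).mul_right _).add
    (h.mul (inFil_exp_sub_one hX))

end NCSeries

namespace FatgraphJohnson

variable {g : ℕ}

namespace MarkedFatgraph

variable (G : MarkedFatgraph g)

/-! # The boundary cycle -/

theorem succ_apply (x : G.Dart) : G.succ x = G.bar (G.next x) := rfl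

theorem succ_bar_tail : G.succ (G.bar G.tail) = G.tail := by
  rw [succ_apply, next_bar_tail, G.bar_bar]

theorem exists_succ_pow (x y : G.Dart) : ∃ n : ℕ, (G.succ ^ n) x = y := by
  obtain ⟨n, -, hn⟩ := (G.one_boundary x y).exists_pow_eq'
  exact ⟨n, hn⟩

theorem succ_pow_succ (n : ℕ) (x : G.Dart) : (G.succ ^ (n + 1)) x = G.succ ((G.succ ^ n) x) := by
  rw [pow_succ', Equiv.Perm.mul_apply]

theorem succ_pow_add (m n : ℕ) (x : G.Dart) :
    (G.succ ^ (m + n)) x = (G.succ ^ m) ((G.succ ^ n) x) := by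
  rw [pow_add, Equiv.Perm.mul_apply]

/-- The position of an oriented edge on the boundary cycle, starting from the tail. -/
noncomputable def pos (x : G.Dart) : ℕ := sInf {n | (G.succ ^ n) G.tail = x}

theorem succ_pow_pos (x : G.Dart) : (G.succ ^ G.pos x) G.tail = x :=
  Nat.sInf_mem (s := {n | (G.succ ^ n) G.tail = x}) (G.exists_succ_pow _ _)

theorem pos_le {x : G.Dart} {n : ℕ} (h : (G.succ ^ n) G.tail = x) : G.pos x ≤ n :=
  Nat.sInf_le h

theorem pos_succ {x : G.Dart} (hx : x ≠ G.bar G.tail) : G.pos (G.succ x) = G.pos x + 1 := by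
  refine le_antisymm (G.pos_le (by rw [succ_pow_succ, succ_pow_pos])) ?_
  have h := G.succ_pow_pos (G.succ x)
  rcases hn : G.pos (G.succ x) with _ | n
  · rw [hn, pow_zero, Equiv.Perm.one_apply, ← succ_bar_tail] at h
    exact absurd (G.succ.injective h).symm hx
  · rw [hn, succ_pow_succ] at h
    exact Nat.succ_le_succ (G.pos_le (G.succ.injective h))

/-- The reversed tail comes last, since its successor is the tail: a larger position could be
shortened by a full turn. -/
theorem pos_le_pos_bar_tail (x : G.Dart) : G.pos x ≤ G.pos (G.bar G.tail) := by
  by_contra! hlt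
  have h := G.succ_pow_pos x
  rw [show G.pos x = (G.pos x - G.pos (G.bar G.tail) - 1) + (G.pos (G.bar G.tail) + 1) by omega,
    succ_pow_add, succ_pow_succ, succ_pow_pos, succ_bar_tail] at h
  have := G.pos_le h
  omega

theorem succ_pow_steps (x : G.Dart) : (G.succ ^ G.steps x) x = G.bar x :=
  Nat.sInf_mem (s := {n | (G.succ ^ n) x = G.bar x}) (G.exists_succ_pow _ _)

/-- If `x` precedes its reverse on the cut boundary cycle, the path between them does not wrap
around. -/
theorem avoidsTail_of_pos_le {x : G.Dart} (h : G.pos x ≤ G.pos (G.bar x)) : G.AvoidsTail x := by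
  intro i hi heq
  have h1 : G.steps x ≤ G.pos (G.bar x) - G.pos x := Nat.sInf_le (by
    change (G.succ ^ _) x = G.bar x
    have e := G.succ_pow_add (G.pos (G.bar x) - G.pos x) (G.pos x) G.tail
    rwa [Nat.sub_add_cancel h, succ_pow_pos, succ_pow_pos, eq_comm] at e)
  have e := G.succ_pow_add i (G.pos x) G.tail
  rw [succ_pow_pos] at e
  rw [← e] at heq
  have h2 := G.pos_le heq
  have h3 := G.pos_le_pos_bar_tail (G.bar x)
  omega

theorem avoidsTail_or (x : G.Dart) : G.AvoidsTail x ∨ G.AvoidsTail (G.bar x) := by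
  rcases le_total (G.pos x) (G.pos (G.bar x)) with h | h
  · exact Or.inl (G.avoidsTail_of_pos_le h)
  · exact Or.inr (G.avoidsTail_of_pos_le (by rwa [G.bar_bar]))

/-- The contribution to path sums of the step from `x` to its successor. -/
noncomputable def corner (L : G.Dart → That g) (x : G.Dart) : That g :=
  hausdorff (L x) (-L (G.succ x))

/-- The sum of the contributions of all steps from the tail up to `x`. -/
noncomputable def potential (L : G.Dart → That g) (x : G.Dart) : That g :=
  ∑ i ∈ Finset.range (G.pos x), G.corner L ((G.succ ^ i) G.tail)

variable {G}

theorem potential_succ (L : G.Dart → That g) {x : G.Dart} (hx : x ≠ G.bar G.tail) :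
    G.potential L (G.succ x) = G.potential L x + G.corner L x := by
  rw [potential, G.pos_succ hx, Finset.sum_range_succ, succ_pow_pos, potential]

/-- The sum telescopes: no step starts at the reversed tail, the only place where the potential
fails to grow by the corner term. -/
theorem pathSum_eq (L : G.Dart → That g) {x : G.Dart} (hx : G.AvoidsTail x) :
    G.pathSum L x = (1 / 3 : ℚ) • (G.potential L x - G.potential L (G.bar x)) := by
  have h : ∀ n ≤ G.steps x, ∑ i ∈ Finset.range n, hausdorff (L ((G.succ ^ i) x))
      (-L ((G.succ ^ (i + 1)) x)) = G.potential L ((G.succ ^ n) x) - G.potential L x := by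
    intro n hn
    induction n with
    | zero => simp
    | succ n ih =>
      rw [Finset.sum_range_succ, ih (by omega), succ_pow_succ, potential_succ L (hx n (by omega)),
        corner]
      abel
  rw [pathSum, h _ le_rfl, succ_pow_steps, neg_smul, ← smul_neg, neg_sub]

theorem ellPartial_one (x : G.Dart) : G.ellPartial 1 x = ofH (cls (G.mark x)) := rfl

theorem ellPartial_of_avoidsTail {x : G.Dart} (hx : G.AvoidsTail x) (n : ℕ) :
    G.ellPartial (n + 2) x =
      G.ellPartial (n + 1) x + homog (n + 2) (G.pathSum (G.ellPartial (n + 1)) x) := by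
  rw [ellPartial, if_pos hx]

theorem ellPartial_of_not_avoidsTail {x : G.Dart} (hx : ¬ G.AvoidsTail x) (n : ℕ) :
    G.ellPartial (n + 2) x =
      G.ellPartial (n + 1) x - homog (n + 2) (G.pathSum (G.ellPartial (n + 1)) (G.bar x)) := by
  rw [ellPartial, if_neg hx, sub_eq_add_neg]

/-- One of `x` and `G.bar x` avoids the tail, and the difference of potentials is odd under
reversal. Both cases of the definition thus give the same formula. -/
theorem ellPartial_add_two (n : ℕ) (x : G.Dart) : G.ellPartial (n + 2) x =
    G.ellPartial (n + 1) x + homog (n + 2) ((1 / 3 : ℚ) •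
      (G.potential (G.ellPartial (n + 1)) x - G.potential (G.ellPartial (n + 1)) (G.bar x))) := by
  by_cases hx : G.AvoidsTail x
  · rw [ellPartial_of_avoidsTail hx, pathSum_eq _ hx]
  · rw [ellPartial_of_not_avoidsTail hx, pathSum_eq _ ((G.avoidsTail_or x).resolve_left hx),
      sub_eq_add_neg, ← map_neg, ← smul_neg, neg_sub, G.bar_bar]

theorem inFil_ellPartial_succ_sub (n : ℕ) (x : G.Dart) :
    InFil (n + 1) (G.ellPartial (n + 1) x - G.ellPartial n x) := by
  rcases n with _ | n
  · simpa [ellPartial] using inFil_ofH (cls (G.mark x))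
  · rw [ellPartial_add_two, add_sub_cancel_left]
    exact inFil_homog _ _

theorem inFil_one_ellPartial (n : ℕ) (x : G.Dart) : InFil 1 (G.ellPartial n x) := by
  induction n with
  | zero => exact InFil.zero 1
  | succ n ih =>
    have := ((inFil_ellPartial_succ_sub n x).mono (by omega)).add ih
    rwa [sub_add_cancel] at this

theorem homog_ellPartial {m n : ℕ} (h : n < m) (x : G.Dart) :
    homog m (G.ellPartial n x) = 0 := by
  induction n with
  | zero => exact map_zero _
  | succ n ih =>
    rcases n with _ | n
    · exact homog_ofH (by omega) _
    · rw [ellPartial_add_two, map_add, ih (by omega), homog_homog_of_ne (by omega), add_zero]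

theorem ellPartial_bar (n : ℕ) (x : G.Dart) :
    G.ellPartial n (G.bar x) = -G.ellPartial n x := by
  induction n with
  | zero => exact neg_zero.symm
  | succ n ih =>
    rcases n with _ | n
    · rw [zero_add, ellPartial_one, ellPartial_one, G.cls_mark_bar, map_neg]
    · rw [ellPartial_add_two, ellPartial_add_two, ih, G.bar_bar, neg_add, ← map_neg, ← smul_neg,
        neg_sub]

/-- The vertex condition holds up to degree `n` for the partial sums of order `n`. -/
theorem inFil_exp_ellPartial_vertex (n : ℕ) {x : G.Dart} (hx : x ≠ G.bar G.tail) :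
    InFil (n + 1) (NCSeries.exp (G.ellPartial n x) * NCSeries.exp (G.ellPartial n (G.next x)) *
      NCSeries.exp (G.ellPartial n (G.next (G.next x))) - 1) := by
  induction n generalizing x with
  | zero =>
    change InFil 1 (NCSeries.exp 0 * NCSeries.exp 0 * NCSeries.exp 0 - 1)
    rw [exp_zero, mul_one, mul_one, sub_self]
    exact InFil.zero 1
  | succ n ih =>
    rcases n with _ | n
    · have h := inFil_exp_triple_perturb (p := 0) (InFil.zero 1) (InFil.zero 1) (InFil.zero 1)
        (inFil_ofH (cls (G.mark x))) (inFil_ofH (cls (G.mark (G.next x))))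
        (inFil_ofH (cls (G.mark (G.next (G.next x)))))
      rw [← map_add, ← map_add, G.cls_mark_vertex hx, map_zero, exp_zero] at h
      simp only [zero_add, mul_one, add_zero] at h
      exact h
    · have hx' := G.next_ne_bar_tail hx
      have hx'' := G.next_ne_bar_tail hx'
      set L := G.ellPartial (n + 1) with hL
      set P := NCSeries.exp (L x) * NCSeries.exp (L (G.next x)) *
        NCSeries.exp (L (G.next (G.next x))) with hP
      have hL1 : ∀ y, InFil 1 (L y) := inFil_one_ellPartial (n + 1)
      have hL0 : ∀ y, homog (n + 2) (L y) = 0 := homog_ellPartial (Nat.lt_succ_self _)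
      -- As `succ y` is the reverse of `next y`, the corner is the Hausdorff term of two consecutive
      -- edges at the vertex; in the next degree it is the defect, because `L` has no component
      -- there.
      have hcorner : ∀ y, y ≠ G.bar G.tail → homog (n + 2) (G.corner L y) =
          homog (n + 2) (NCSeries.exp (L y) * NCSeries.exp (L (G.next y)) *
            NCSeries.exp (L (G.next (G.next y))) - 1) := fun y hy => by
        rw [corner, succ_apply, hL, ellPartial_bar, neg_neg, ← hL,
          (inFil_hausdorff (hL1 _) (ih hy)).homog_eq (Nat.lt_succ_self _),
          map_sub _ _ (L y + L (G.next y) + L (G.next (G.next y))), map_add, map_add, hL0, hL0, hL0,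
          add_zero, add_zero, sub_zero]
      have hrot : ∀ y, y ≠ G.bar G.tail → homog (n + 2) (G.corner L (G.next y)) =
          homog (n + 2) (G.corner L y) := fun y hy => by
        rw [hcorner y hy, hcorner _ (G.next_ne_bar_tail hy), G.next_next_next, map_sub, map_sub,
          (inFil_exp_rotate (hL1 y) (ih hy)).homog_eq (Nat.lt_succ_self _)]
      have hs : ∀ y, y ≠ G.bar G.tail → G.potential L (G.bar (G.next y)) =
          G.potential L y + G.corner L y := fun y hy => potential_succ L hy
      have h := inFil_exp_triple_perturb (p := n + 1) (hL1 x) (hL1 (G.next x))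
        (hL1 (G.next (G.next x)))
        (inFil_homog (n + 2) ((1 / 3 : ℚ) • (G.potential L x - G.potential L (G.bar x))))
        (inFil_homog (n + 2) ((1 / 3 : ℚ) •
          (G.potential L (G.next x) - G.potential L (G.bar (G.next x)))))
        (inFil_homog (n + 2) ((1 / 3 : ℚ) •
          (G.potential L (G.next (G.next x)) - G.potential L (G.bar (G.next (G.next x))))))
      simp only [hL, ← ellPartial_add_two] at h
      refine h.trans ?_
      simp only [← hL, ← hP]
      -- Each reversed edge is the successor of another edge at the vertex, so the potentials cancel
      -- and leave minus the three corners. By rotation invariance these are equal in this degree,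
      -- whence the factor `1 / 3`.
      have hsum : homog (n + 2) ((1 / 3 : ℚ) • (G.potential L x - G.potential L (G.bar x))) +
          homog (n + 2) ((1 / 3 : ℚ) •
            (G.potential L (G.next x) - G.potential L (G.bar (G.next x)))) +
          homog (n + 2) ((1 / 3 : ℚ) • (G.potential L (G.next (G.next x)) -
            G.potential L (G.bar (G.next (G.next x))))) = -homog (n + 2) (P - 1) := by
        have h3 := hs _ hx''
        rw [G.next_next_next] at h3
        rw [hs _ hx, hs _ hx', h3, ← hcorner x hx]
        simp only [map_smul, map_sub, map_add]
        rw [hrot _ hx', hrot _ hx]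
        module
      rw [hsum, show P + -homog (n + 2) (P - 1) - 1 = P - 1 - homog (n + 2) (P - 1) by abel]
      exact (ih hx).sub_homog

theorem inFil_ellPartial_sub {m n : ℕ} (h : n ≤ m) (x : G.Dart) :
    InFil (n + 1) (G.ellPartial m x - G.ellPartial n x) := by
  induction m, h using Nat.le_induction with
  | base => simpa using InFil.zero (n + 1)
  | succ m hm ih => exact ((inFil_ellPartial_succ_sub m x).mono (by omega)).trans ih

theorem inFil_ell_sub (n : ℕ) (x : G.Dart) : InFil (n + 1) (G.ell x - G.ellPartial n x) :=
  fun w hw => by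
    rw [coeff_sub, sub_eq_zero]
    exact ((inFil_ellPartial_sub (Nat.lt_succ_iff.1 hw) x).coeff_eq (Nat.lt_succ_self _)).symm

theorem inFil_ell (x : G.Dart) : InFil 1 (G.ell x) := by
  simpa [ellPartial] using inFil_ell_sub 0 x

theorem inFil_ell_sub_ofH (x : G.Dart) : InFil 2 (G.ell x - ofH (cls (G.mark x))) :=
  inFil_ell_sub 1 x

theorem ell_bar (x : G.Dart) : G.ell (G.bar x) = -G.ell x := by
  ext w
  simp [ell, ellPartial_bar]

theorem exp_ell_bar (x : G.Dart) :
    NCSeries.exp (G.ell (G.bar x)) * NCSeries.exp (G.ell x) = 1 := by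
  rw [ell_bar, exp_neg_mul_exp (inFil_ell x)]

theorem exp_ell_vertex {x : G.Dart} (hx : x ≠ G.bar G.tail) :
    NCSeries.exp (G.ell x) * NCSeries.exp (G.ell (G.next x)) *
      NCSeries.exp (G.ell (G.next (G.next x))) = 1 :=
  InFil.ext_of_sub fun n => by
    refine InFil.trans ?_ ((inFil_exp_ellPartial_vertex n hx).mono (Nat.le_succ n))
    exact (((inFil_ell_sub n _).exp_sub_exp.mul_sub_mul (inFil_ell_sub n _).exp_sub_exp).mul_sub_mul
      (inFil_ell_sub n _).exp_sub_exp).mono (Nat.le_succ n)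

/-! # Naturality of the series `ℓ` -/

/-- The underlying fatgraph, and with it every boundary path, is unchanged. Only the marks move, and
`homAct` commutes with each operation of the recursion. -/
theorem ell_act (φ : MCG g) (x : G.Dart) : (G.act φ).ell x = homAct φ.1 (G.ell x) := by
  have h : ∀ n (x : G.Dart), (G.act φ).ellPartial n x = homAct φ.1 (G.ellPartial n x) := by
    intro n
    induction n with
    | zero => exact fun x => ((homActLinear φ.1).map_zero).symm
    | succ n ih =>
      intro x
      rcases n with _ | n
      · exact (homAct_ofH_cls φ.1 (G.mark x)).symm
      · have hp : ∀ y : G.Dart, (G.act φ).pathSum ((G.act φ).ellPartial (n + 1)) y =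
            homAct φ.1 (G.pathSum (G.ellPartial (n + 1)) y) := fun y => by
          change (-(1 / 3) : ℚ) • ∑ i ∈ Finset.range (G.steps y),
            hausdorff ((G.act φ).ellPartial (n + 1) ((G.succ ^ i) y))
              (-(G.act φ).ellPartial (n + 1) ((G.succ ^ (i + 1)) y)) =
            homActLinear φ.1 _
          rw [pathSum, map_smul, map_sum]
          congr 1
          refine Finset.sum_congr rfl fun i _ => ?_
          rw [ih, ih, ← homAct_neg, ← homAct_hausdorff]
          rfl
        have hA : (G.act φ).AvoidsTail x ↔ G.AvoidsTail x := Iff.rfl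
        by_cases hx : G.AvoidsTail x
        · rw [ellPartial_of_avoidsTail hx, ellPartial_of_avoidsTail (hA.2 hx), homAct_add, ih, hp,
            homAct_homog]
        · rw [ellPartial_of_not_avoidsTail hx, ellPartial_of_not_avoidsTail (mt hA.1 hx),
            homAct_sub, ih, homAct_homog, ← hp]
          rfl
  ext w
  change ((G.act φ).ellPartial w.length x).coeff w = _
  rw [h]
  simp only [homAct, ell, List.length_ofFn]

theorem ell_iso {G' : MarkedFatgraph g} (f : G.Dart ≃ G'.Dart)
    (hbar : ∀ x, f (G.bar x) = G'.bar (f x)) (hnext : ∀ x, f (G.next x) = G'.next (f x))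
    (htail : f G.tail = G'.tail) (hmark : ∀ x, G'.mark (f x) = G.mark x) (x : G.Dart) :
    G'.ell (f x) = G.ell x := by
  have hsucc : ∀ (i : ℕ) x, (G'.succ ^ i) (f x) = f ((G.succ ^ i) x) := fun i x => by
    induction i with
    | zero => rfl
    | succ i ih => rw [succ_pow_succ, succ_pow_succ, ih, succ_apply, succ_apply, hbar, hnext]
  have hsteps : ∀ x, G'.steps (f x) = G.steps x := fun x => by
    simp only [steps, hsucc, ← hbar, f.injective.eq_iff]
  have hA : ∀ x, G'.AvoidsTail (f x) ↔ G.AvoidsTail x := fun x => by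
    simp only [AvoidsTail, hsucc, hsteps, ← htail, ← hbar, f.injective.ne_iff]
  have h : ∀ n x, G'.ellPartial n (f x) = G.ellPartial n x := by
    intro n
    induction n with
    | zero => exact fun _ => rfl
    | succ n ih =>
      intro x
      rcases n with _ | n
      · rw [zero_add, ellPartial_one, ellPartial_one, hmark]
      · have hp : ∀ y, G'.pathSum (G'.ellPartial (n + 1)) (f y) =
            G.pathSum (G.ellPartial (n + 1)) y := fun y => by
          simp only [pathSum, hsteps, hsucc, ih]
        by_cases hx : G.AvoidsTail x
        · rw [ellPartial_of_avoidsTail hx, ellPartial_of_avoidsTail ((hA x).2 hx), ih, hp]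
        · rw [ellPartial_of_not_avoidsTail hx, ellPartial_of_not_avoidsTail (mt (hA x).1 hx), ih,
            ← hbar, hp]
  ext w
  change (G'.ellPartial w.length (f x)).coeff w = (G.ellPartial w.length x).coeff w
  rw [h]

end MarkedFatgraph

end FatgraphJohnson
namespace FatgraphJohnson

variable {g : ℕ}

namespace MarkedFatgraph

/-! # Existence and uniqueness of the fatgraph Magnus expansion -/

variable (G : MarkedFatgraph g)

/-- Values on the oriented edges that satisfy the relations of a marking extend to a Magnus
expansion. -/
theorem exists_isMagnus_extension (E : G.Dart → (That g)ˣ)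
    (hE : ∀ x, InFil 2 ((E x : That g) - (1 + ofH (cls (G.mark x)))))
    (hbar : ∀ x, E (G.bar x) * E x = 1)
    (hvertex : ∀ x, x ≠ G.bar G.tail → E x * E (G.next x) * E (G.next (G.next x)) = 1) :
    ∃ θ : Pi1 g →* That g, IsMagnus θ ∧ ∀ x, θ (G.mark x) = E x := by
  let M : FreeGroup G.Dart →* Pi1 g := FreeGroup.lift G.mark
  let F : FreeGroup G.Dart →* That g := (Units.coeHom (That g)).comp (FreeGroup.lift E)
  have hMof : ∀ x, M (FreeGroup.of x) = G.mark x := fun x => FreeGroup.lift_apply_of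
  have hFof : ∀ x, F (FreeGroup.of x) = E x := fun x => by simp [F]
  have hsurj : ∀ i : Idx g, ∃ y, M y = FreeGroup.of i := fun i => by
    have h : Subgroup.closure (Set.range G.mark) ≤ M.range := by
      rw [Subgroup.closure_le]
      rintro _ ⟨x, rfl⟩
      exact ⟨FreeGroup.of x, hMof x⟩
    exact h (G.mark_full ▸ Subgroup.mem_top _)
  choose σ hσ using hsurj
  have hF2 : ∀ y, InFil 2 (F y - (1 + ofH (cls (M y)))) :=
    inFil_two_of_generators (κ := (clsHom g).comp M) fun x => by
      have := hE x
      rwa [← hFof, ← hMof] at this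
  have hF1 : ∀ y, InFil 1 (F y - 1) := fun y => by
    have := ((hF2 y).mono one_le_two).add (inFil_ofH (cls (M y)))
    rwa [← sub_sub, sub_add_cancel] at this
  -- The only candidate on the free generators, built from arbitrary lifts `σ i`. What has to be
  -- shown is that `F` depends on the image under `M` alone.
  let θ : Pi1 g →* That g :=
    (Units.coeHom (That g)).comp (FreeGroup.lift fun i => FreeGroup.lift E (σ i))
  have hθof : ∀ i, θ (FreeGroup.of i) = F (σ i) := fun i => by simp [θ, F]
  have hθ : IsMagnus θ := isMagnus_of_generators fun i => by
    have := hF2 (σ i)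
    rwa [hσ, cls_of, ← hθof] at this
  have key : ∀ n y, InFil n (F y - θ (M y)) := by
    intro n
    induction n with
    | zero => exact fun y => InFil.zero_fil _
    | succ n ih =>
      suffices hw : ∀ w : List (Idx g), w.length = n → ∀ y, (F y - θ (M y)).coeff w = 0 from
        fun y w hlt => (Nat.lt_succ_iff_lt_or_eq.1 hlt).elim (ih y w) fun h => hw w h y
      intro w hwn
      -- As `F` and `θ ∘ M` agree below degree `n`, a coefficient of degree `n` of their difference
      -- is additive in `y`; it vanishes on the edge and vertex relations.
      let d : FreeGroup G.Dart →* Multiplicative ℚ :=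
        { toFun := fun y => Multiplicative.ofAdd ((F y - θ (M y)).coeff w)
          map_one' := by simp
          map_mul' := fun y z => by
            have e : F (y * z) - θ (M (y * z)) - ((F y - θ (M y)) + (F z - θ (M z))) =
                (F y - θ (M y)) * (F z - 1) + (θ (M y) - 1) * (F z - θ (M z)) := by
              simp only [map_mul]
              noncomm_ring
            have h : InFil (n + 1) (F (y * z) - θ (M (y * z)) -
                ((F y - θ (M y)) + (F z - θ (M z)))) := by
              rw [e]
              exact ((ih y).mul (hF1 z)).add
                (((hθ.inFil_sub_one _).mul (ih z)).mono (by omega))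
            rw [h.coeff_eq (by omega), coeff_add, ofAdd_add] }
      have hd0 : ∀ y, F y = 1 → M y = 1 → d y = 1 := fun y h1 h2 => by
        change Multiplicative.ofAdd ((F y - θ (M y)).coeff w) = 1
        rw [h1, h2, map_one, sub_self]
        rfl
      let c : G.Dart → ℚ := fun x => (d (FreeGroup.of x)).toAdd
      have hc : c ∈ G.additiveFunctions := by
        refine ⟨fun x => ?_, fun x hx => ?_⟩
        · have := hd0 (FreeGroup.of (G.bar x) * FreeGroup.of x)
            (by rw [map_mul, hFof, hFof, ← Units.val_mul, hbar, Units.val_one])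
            (by rw [map_mul, hMof, hMof, G.mark_bar])
          rw [map_mul] at this
          exact eq_neg_of_add_eq_zero_left this
        · have := hd0 (FreeGroup.of x * FreeGroup.of (G.next x) * FreeGroup.of (G.next (G.next x)))
            (by rw [map_mul, map_mul, hFof, hFof, hFof, ← Units.val_mul, ← Units.val_mul,
              hvertex x hx, Units.val_one])
            (by rw [map_mul, map_mul, hMof, hMof, hMof, G.mark_vertex x hx])
          rw [map_mul, map_mul] at this
          exact this
      obtain ⟨f, hf⟩ := G.exists_eq_linear hc
      have hdf : d = (AddMonoidHom.toMultiplicative f.toAddMonoidHom).comp ((clsHom g).comp M) :=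
        FreeGroup.ext_hom _ _ fun x => by
          have := hf x
          rw [← hMof] at this
          exact congrArg Multiplicative.ofAdd this
      have hdy : ∀ y, (F y - θ (M y)).coeff w = f (cls (M y)) := fun y =>
        congrArg Multiplicative.toAdd (DFunLike.congr_fun hdf y)
      -- The difference vanishes on the lifts `σ i` by construction, and their classes form the
      -- basis of `H`.
      have hf0 : f = 0 := LinearMap.pi_ext' fun i => LinearMap.ext_ring <| by
        have := hdy (σ i)
        rw [hσ, hθof, sub_self, cls_of] at this
        exact this.symm
      intro y
      rw [hdy, hf0, LinearMap.zero_apply]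
  refine ⟨θ, hθ, fun x => (InFil.ext_of_sub fun n => ?_).symm⟩
  have := key n (FreeGroup.of x)
  rwa [hFof, hMof] at this

theorem existsUnique_isFatgraphMagnus : ∃! θ : Pi1 g →* That g, G.IsFatgraphMagnus θ := by
  let E : G.Dart → (That g)ˣ := fun x =>
    ⟨NCSeries.exp (G.ell x), NCSeries.exp (-G.ell x), exp_mul_exp_neg (inFil_ell x),
      exp_neg_mul_exp (inFil_ell x)⟩
  obtain ⟨θ, hθ, hθE⟩ := G.exists_isMagnus_extension E
    (fun x => by
      have h := inFil_exp_add (p := 0) (InFil.zero 1) (inFil_ell x)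
      rw [zero_add (G.ell x), exp_zero] at h
      have h' : InFil 2 (1 + G.ell x - (1 + ofH (cls (G.mark x)))) := by
        rw [add_sub_add_left_eq_sub]
        exact inFil_ell_sub_ofH x
      exact h.trans h')
    (fun x => Units.ext (exp_ell_bar x)) (fun x hx => Units.ext (exp_ell_vertex hx))
  refine ⟨θ, ⟨hθ, hθE⟩, fun θ' hθ' => ?_⟩
  refine MonoidHom.eq_of_eqOn_dense G.mark_full ?_
  rintro _ ⟨x, rfl⟩
  rw [hθ'.2, hθE]

theorem isFatgraphMagnus_magnus : G.IsFatgraphMagnus G.magnus :=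
  Classical.epsilon_spec G.existsUnique_isFatgraphMagnus.exists

theorem isMagnus_magnus : IsMagnus G.magnus := G.isFatgraphMagnus_magnus.1

variable {G}

theorem magnus_eq {θ : Pi1 g →* That g} (hθ : G.IsFatgraphMagnus θ) : G.magnus = θ :=
  G.existsUnique_isFatgraphMagnus.unique G.isFatgraphMagnus_magnus hθ

theorem isFatgraphMagnus_act (φ : MCG g) :
    (G.act φ).IsFatgraphMagnus (conjExpansion φ.1 G.magnus) := by
  have h (x : G.Dart) :
      conjExpansion φ.1 G.magnus (φ.1 (G.mark x)) = NCSeries.exp ((G.act φ).ell x) := by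
    rw [conjExpansion_apply, G.isFatgraphMagnus_magnus.2, homAct_exp, ell_act]
  exact ⟨G.isMagnus_magnus.conjExpansion φ.1, h⟩

theorem IsFatgraphMagnus.of_iso {G' : MarkedFatgraph g} {θ : Pi1 g →* That g}
    (hθ : G.IsFatgraphMagnus θ) (h : G'.Iso G) : G'.IsFatgraphMagnus θ := by
  obtain ⟨f, hbar, hnext, htail, hmark⟩ := h
  exact ⟨hθ.1, fun x => by rw [← hmark, ← ell_iso f hbar hnext htail hmark, hθ.2]⟩

end MarkedFatgraph

end FatgraphJohnson
-- Johnson homomorphisms as sums over sequences of moves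
theorem theorem4p5 (g : ℕ) (hg : 0 < g) (φ : MCG g) (k : ℕ) (G : Fin (k + 1) → MarkedFatgraph g)
    (hW : ∀ i : Fin k, (G i.castSucc).WhiteheadMove (G i.succ))
    (hφ : (G (Fin.last k)).Iso ((G 0).act φ)) :
    -- the fatgraph Magnus expansions and the fatgraph Johnson maps exist and are unique
    (∀ i, ∃! θ : Pi1 g →* That g, (G i).IsFatgraphMagnus θ) ∧
    (∀ i : Fin k, ∃! U, Takes (G i.succ).magnus (G i.castSucc).magnus U) ∧
    -- `τ₁` on the whole mapping class group, for the expansion of the first fatgraph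
    (∃! U, Takes (fun x => homAct φ.1 ((G 0).magnus x)) (fun x => (G 0).magnus (φ.1 x)) U) ∧
    component 1 (totalJohnson (G 0).magnus φ) = ∑ i : Fin k, moveJohnson G 1 i ∧
    -- the first Johnson homomorphism, for every expansion, on the Torelli group
    (φ ∈ torelli g 1 →
      johnsonHom 1 φ = ∑ i : Fin k, moveJohnson G 1 i ∧
      ∀ θ : Pi1 g →* That g, IsMagnus θ →
        (∃! U, Takes θ (fun x => θ (φ.1 x)) U) ∧
        component 1 (totalJohnson θ φ) = ∑ i : Fin k, moveJohnson G 1 i) ∧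
    -- the second Johnson homomorphism, for every expansion, on the second Torelli group
    (φ ∈ torelli g 2 →
      johnsonHom 2 φ = ∑ i : Fin k, (moveJohnson G 2 i -
          deriv2 (moveJohnson G 1 i) ∘ₗ ∑ j ∈ Finset.Iic i, moveJohnson G 1 j) ∧
      ∀ θ : Pi1 g →* That g, IsMagnus θ →
        (∃! U, Takes θ (fun x => θ (φ.1 x)) U) ∧
        component 2 (totalJohnson θ φ) = ∑ i : Fin k, (moveJohnson G 2 i -
          deriv2 (moveJohnson G 1 i) ∘ₗ ∑ j ∈ Finset.Iic i, moveJohnson G 1 j)) := by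
  have hmagnus : ∀ i, IsMagnus (G i).magnus := fun i => (G i).isMagnus_magnus
  have htotal : totalJohnson (G 0).magnus φ =
      transition (G 0).magnus (G (Fin.last k)).magnus := by
    rw [totalJohnson_eq,
      MarkedFatgraph.magnus_eq ((MarkedFatgraph.isFatgraphMagnus_act φ).of_iso hφ)]
  have h1 : component 1 (totalJohnson (G 0).magnus φ) = ∑ i : Fin k, moveJohnson G 1 i := by
    rw [htotal]
    exact component_one_transition_last (fun i => (G i).magnus) hmagnus
  have h1' : ∀ θ : Pi1 g →* That g, IsMagnus θ → φ ∈ torelli g 1 →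
      component 1 (totalJohnson θ φ) = ∑ i : Fin k, moveJohnson G 1 i := fun θ hθ hT => by
    rw [component_one_totalJohnson hθ (hmagnus 0) hT, h1]
  have h2 : φ ∈ torelli g 2 → component 2 (totalJohnson (G 0).magnus φ) =
      ∑ i : Fin k, (moveJohnson G 2 i -
        deriv2 (moveJohnson G 1 i) ∘ₗ ∑ j ∈ Finset.Iic i, moveJohnson G 1 j) := fun hT => by
    -- The vanishing of `τ₁(φ)`, which allows the later moves in the cross terms to be traded for
    -- the earlier ones together with the move itself.
    have h0 : ∑ j : Fin k, moveJohnson G 1 j = 0 := by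
      rw [← h1, component_one_totalJohnson_eq_zero (hmagnus 0) hT]
    rw [htotal]
    refine (component_two_transition_last (fun i => (G i).magnus) hmagnus).trans ?_
    refine Finset.sum_congr rfl fun i _ => ?_
    have hsplit : ∑ j ∈ Finset.Ioi i, moveJohnson G 1 j = -∑ j ∈ Finset.Iic i, moveJohnson G 1 j := by
      rw [eq_neg_iff_add_eq_zero, ← h0, ← Finset.sum_union]
      · congr 1
        ext j
        simpa using lt_or_ge i j
      · exact Finset.disjoint_left.2 fun j hj hj' =>
          absurd (Finset.mem_Ioi.1 hj) (not_lt.2 (Finset.mem_Iic.1 hj'))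
    change moveJohnson G 2 i +
      deriv2 (moveJohnson G 1 i) ∘ₗ ∑ j ∈ Finset.Ioi i, moveJohnson G 1 j = _
    rw [hsplit, LinearMap.comp_neg, sub_eq_add_neg]
  have h2' : ∀ θ : Pi1 g →* That g, IsMagnus θ → φ ∈ torelli g 2 →
      component 2 (totalJohnson θ φ) = ∑ i : Fin k, (moveJohnson G 2 i -
        deriv2 (moveJohnson G 1 i) ∘ₗ ∑ j ∈ Finset.Iic i, moveJohnson G 1 j) := fun θ hθ hT => by
    rw [component_two_totalJohnson hθ (hmagnus 0) hT, h2 hT]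
  refine ⟨fun i => (G i).existsUnique_isFatgraphMagnus,
    fun i => (hmagnus _).existsUnique_takes (hmagnus _),
    existsUnique_takes_homAct (hmagnus 0) φ, h1, fun hT => ⟨?_, fun θ hθ =>
      ⟨existsUnique_takes_torelli hθ hT, h1' θ hθ hT⟩⟩, fun hT => ⟨?_, fun θ hθ =>
      ⟨existsUnique_takes_torelli hθ (torelli_antitone one_le_two hT), h2' θ hθ hT⟩⟩⟩
  · rw [johnsonHom_eq_component le_rfl hT, h1' _ isMagnus_stdMagnus hT]
  · rw [johnsonHom_eq_component one_le_two hT, h2' _ isMagnus_stdMagnus hT]
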